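/- Let $A=L^\infty(\mathbb R)$ (Lebesgue measure, complex-valued functions), with its weak* topology $\sigma(L^\infty,L^1)$, and let $A\odot A$ be the algebraic tensor product. A \emph{weak* tensor product} $A\overline\otimes_\alpha A$ is the weak* closure of $\alpha(A\odot A)$ in $B(H)$, where $\alpha\colon A\odot A\to B(H)$ is an injective unital $*$-representation on a Hilbert space $H$ whose restrictions to $A\otimes 1$ and $1\otimes A$ are weak* homeomorphisms onto their ranges. It is \emph{maximal}, written $A\overline\otimes_{w^*\text{-max}}A$, if for every weak* tensor product $A\overline\otimes_\beta A$ the identity of $A\odot A$ extends to a normal (i.e. weak* continuous) $*$-homomorphism from $A\overline\otimes_\alpha A$ to $A\overline\otimes_\beta A$ (which is then automatically onto). For $x\in\mathbb R$ let $\mu_x$ be the measure on $\mathbb R\times\mathbb R$ with $\int f\,d\mu_x=\int_{\mathbb R}f(y,x+y)\,dy$, and let $\xi_x\in L^2(\mu_x)$ be the characteristic function of $[0,1]\times[x,1+x]$. A maximal weak* tensor product of $A$ with itself exists. Let $S=A\overline\otimes_\alpha A$ be any maximal weak* tensor product of $A$ with itself. Then the predual of $S$ (the space of all normal linear functionals on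 $S$, with the norm of $S^*$) is not separable. More precisely, for every $x\in\mathbb R$ there are a normal $*$-representation $\widetilde\pi_x\colon S\to B(L^2(\mu_x))$ such that, for all $f,g\in A$, $\widetilde\pi_x(\alpha(f\otimes g))$ is multiplication by the function $(s,t)\mapsto f(s)g(t)$, and a functional $\varphi_x$ in the predual of $S$ with $$\varphi_x(T)=\langle\widetilde\pi_x(T)\xi_x,\xi_x\rangle\quad(T\in S),\qquad \varphi_x(\alpha(f\otimes g))=\int_{[0,1]}f(y)\,g(x+y)\,dy\quad(f,g\in A),$$ and these satisfy $\|\varphi_x-\varphi_y\|\ge 1$ for all $x\neq y$. -/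

import Mathlib

open MeasureTheory TensorProduct
open scoped ENNReal InnerProductSpace Topology

noncomputable section

/-! ### The star algebra `L^∞(μ)` with its weak* topology -/

/-- The algebra `L^∞(μ)` of essentially bounded complex functions modulo a.e. equality.  It is a
type synonym of `Lp ℂ ∞ μ`, so that it can carry the weak* topology `σ(L^∞, L¹)`
(and not the norm topology). -/
def LInf {X : Type*} [MeasurableSpace X] (μ : Measure X) : Type _ := Lp ℂ ∞ μ

namespace LInf

variable {X : Type*} [MeasurableSpace X] {μ : Measure X}

instance : CoeFun (LInf μ) (fun _ => X → ℂ) := ⟨fun f => AEEqFun.cast (Subtype.val (p := fun g => g ∈ Lp ℂ ∞ μ) f)⟩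

instance : AddCommGroup (LInf μ) := inferInstanceAs (AddCommGroup (Lp ℂ ∞ μ))

instance : Module ℂ (LInf μ) := inferInstanceAs (Module ℂ (Lp ℂ ∞ μ))

/-- The pointwise product. -/
instance : Mul (LInf μ) :=
  ⟨fun f g => ((Lp.memLp (g : Lp ℂ ∞ μ)).mul (r := ∞) (Lp.memLp (f : Lp ℂ ∞ μ))).toLp (⇑f * ⇑g)⟩

/-- The constant function `1`. -/
instance : One (LInf μ) := ⟨(memLp_top_const (1 : ℂ)).toLp (fun _ => (1 : ℂ))⟩

/-- Pointwise complex conjugation. -/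
instance : Star (LInf μ) := inferInstanceAs (Star (Lp ℂ ∞ μ))

theorem ext {f g : LInf μ} (h : ⇑f =ᵐ[μ] ⇑g) : f = g := Lp.ext h

theorem coeFn_mul (f g : LInf μ) : ⇑(f * g) =ᵐ[μ] fun x => f x * g x :=
  MemLp.coeFn_toLp _

theorem coeFn_one : ⇑(1 : LInf μ) =ᵐ[μ] fun _ => 1 := MemLp.coeFn_toLp _

theorem coeFn_add (f g : LInf μ) : ⇑(f + g) =ᵐ[μ] fun x => f x + g x := Lp.coeFn_add _ _

theorem coeFn_zero : ⇑(0 : LInf μ) =ᵐ[μ] fun _ => 0 := Lp.coeFn_zero _ _ _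

theorem coeFn_smul (c : ℂ) (f : LInf μ) : ⇑(c • f) =ᵐ[μ] fun x => c * f x := Lp.coeFn_smul _ _

theorem coeFn_star (f : LInf μ) : ⇑(star f) =ᵐ[μ] fun x => star (f x) := Lp.coeFn_star _

instance : CommRing (LInf μ) :=
  { (inferInstance : AddCommGroup (LInf μ)) with
    mul := (· * ·)
    one := 1
    mul_assoc := fun f g h => ext <| by
      filter_upwards [coeFn_mul (f * g) h, coeFn_mul f g, coeFn_mul f (g * h), coeFn_mul g h]
        with x h1 h2 h3 h4
      rw [h1, h2, h3, h4, mul_assoc]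
    mul_comm := fun f g => ext <| by
      filter_upwards [coeFn_mul f g, coeFn_mul g f] with x h1 h2
      rw [h1, h2, mul_comm]
    one_mul := fun f => ext <| by
      filter_upwards [coeFn_mul 1 f, coeFn_one (μ := μ)] with x h1 h2
      rw [h1, h2, one_mul]
    mul_one := fun f => ext <| by
      filter_upwards [coeFn_mul f 1, coeFn_one (μ := μ)] with x h1 h2
      rw [h1, h2, mul_one]
    zero_mul := fun f => ext <| by
      filter_upwards [coeFn_mul 0 f, coeFn_zero (μ := μ)] with x h1 h2
      rw [h1, h2, zero_mul]
    mul_zero := fun f => ext <| by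
      filter_upwards [coeFn_mul f 0, coeFn_zero (μ := μ)] with x h1 h2
      rw [h1, h2, mul_zero]
    left_distrib := fun f g h => ext <| by
      filter_upwards [coeFn_mul f (g + h), coeFn_add g h, coeFn_add (f * g) (f * h),
        coeFn_mul f g, coeFn_mul f h] with x h1 h2 h3 h4 h5
      rw [h1, h2, h3, h4, h5, mul_add]
    right_distrib := fun f g h => ext <| by
      filter_upwards [coeFn_mul (f + g) h, coeFn_add f g, coeFn_add (f * h) (g * h),
        coeFn_mul f h, coeFn_mul g h] with x h1 h2 h3 h4 h5
      rw [h1, h2, h3, h4, h5, add_mul] }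

instance : Algebra ℂ (LInf μ) :=
  Algebra.ofModule
    (fun c f g => ext <| by
      filter_upwards [coeFn_mul (c • f) g, coeFn_smul c f, coeFn_smul c (f * g), coeFn_mul f g]
        with x h1 h2 h3 h4
      rw [h1, h2, h3, h4, mul_assoc])
    (fun c f g => ext <| by
      filter_upwards [coeFn_mul f (c • g), coeFn_smul c g, coeFn_smul c (f * g), coeFn_mul f g]
        with x h1 h2 h3 h4
      rw [h1, h2, h3, h4, mul_left_comm])

instance : StarRing (LInf μ) where
  star_involutive f := ext <| by
    filter_upwards [coeFn_star (star f), coeFn_star f] with x h1 h2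
    rw [h1, h2, star_star]
  star_mul f g := ext <| by
    filter_upwards [coeFn_star (f * g), coeFn_mul f g, coeFn_mul (star g) (star f),
      coeFn_star f, coeFn_star g] with x h1 h2 h3 h4 h5
    rw [h1, h2, h3, h4, h5, star_mul]
  star_add f g := ext <| by
    filter_upwards [coeFn_star (f + g), coeFn_add f g, coeFn_add (star f) (star g),
      coeFn_star f, coeFn_star g] with x h1 h2 h3 h4 h5
    rw [h1, h2, h3, h4, h5, star_add]

instance : StarModule ℂ (LInf μ) where
  star_smul c f := ext <| by
    filter_upwards [coeFn_star (c • f), coeFn_smul c f, coeFn_smul (star c) (star f),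
      coeFn_star f] with x h1 h2 h3 h4
    rw [h1, h2, h3, h4, star_mul']

/-- The weak* topology `σ(L^∞(μ), L¹(μ))`: the coarsest one that makes `f ↦ ∫ f h ∂μ` continuous
for every `h ∈ L¹(μ)`. -/
instance : TopologicalSpace (LInf μ) :=
  ⨅ h : Lp ℂ 1 μ, TopologicalSpace.induced (fun f : LInf μ => ∫ x, f x * h x ∂μ) inferInstance

end LInf

/-! ### The weak* topology of `B(H)` -/

section Ultraweak

set_option linter.unusedSectionVars false

variable (H : Type*) [NormedAddCommGroup H] [InnerProductSpace ℂ H] [CompleteSpace H]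

/-- The weak* (ultraweak, σ-weak) topology of `B(H)`: the coarsest one that makes
`T ↦ ∑ₙ ⟪ξₙ, T ηₙ⟫` continuous for all sequences with `∑ ‖ξₙ‖² < ∞`, `∑ ‖ηₙ‖² < ∞`. -/
@[reducible]
def ultraweak : TopologicalSpace (H →L[ℂ] H) :=
  ⨅ p : lp (fun _ : ℕ => H) 2 × lp (fun _ : ℕ => H) 2,
    TopologicalSpace.induced (fun T : H →L[ℂ] H => ∑' n, ⟪p.1 n, T (p.2 n)⟫_ℂ) inferInstance

variable {H}

/-- The sequence `(A ηₙ)ₙ` for a square summable sequence `η` and a bounded operator `A`. -/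
def ampApply (A : H →L[ℂ] H) (η : lp (fun _ : ℕ => H) 2) : lp (fun _ : ℕ => H) 2 :=
  ⟨fun n => A (η n), by
    have h : Summable fun n => ‖η n‖ ^ (2 : ℝ≥0∞).toReal :=
      Memℓp.summable (E := fun _ : ℕ => H) (p := 2) (by norm_num) (lp.memℓp η)
    refine memℓp_gen (E := fun _ : ℕ => H) (p := 2)
      (Summable.of_nonneg_of_le (fun n => by positivity) (fun n => ?_)
        (h.mul_left (‖A‖ ^ (2 : ℝ≥0∞).toReal)))
    rw [← Real.mul_rpow (norm_nonneg _) (norm_nonneg _)]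
    exact Real.rpow_le_rpow (norm_nonneg _) (A.le_opNorm _) (by norm_num)⟩

theorem ultraweak_functional_continuous (ξ η : lp (fun _ : ℕ => H) 2) :
    Continuous[ultraweak H, inferInstance]
      (fun T : H →L[ℂ] H => ∑' n, ⟪ξ n, T (η n)⟫_ℂ) :=
  continuous_iff_le_induced.2 (iInf_le _ (ξ, η))

theorem continuous_ultraweak_rng {Y : Type*} [t : TopologicalSpace Y] {f : Y → (H →L[ℂ] H)}
    (h : ∀ ξ η : lp (fun _ : ℕ => H) 2, Continuous fun y => ∑' n, ⟪ξ n, f y (η n)⟫_ℂ) :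
    Continuous[t, ultraweak H] f :=
  continuous_iInf_rng.2 fun p => continuous_induced_rng.2 (h p.1 p.2)

theorem summable_ultraweak (ξ η : lp (fun _ : ℕ => H) 2) (T : H →L[ℂ] H) :
    Summable fun n => ⟪ξ n, T (η n)⟫_ℂ :=
  lp.summable_inner (𝕜 := ℂ) (G := fun _ : ℕ => H) ξ (ampApply T η)

theorem ultraweak_semitopological :
    @IsSemitopologicalSemiring (H →L[ℂ] H) (ultraweak H) _ := by
  let _ : TopologicalSpace (H →L[ℂ] H) := ultraweak H
  refine
    { continuous_add := ?_
      continuous_const_mul := fun {A} => ?_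
      continuous_mul_const := fun {A} => ?_ }
  · refine continuous_ultraweak_rng fun ξ η => ?_
    have h := ((ultraweak_functional_continuous ξ η).comp continuous_fst).add
      ((ultraweak_functional_continuous ξ η).comp continuous_snd)
    refine h.congr fun p => ?_
    simp only [add_apply, inner_add_right]
    exact ((summable_ultraweak ξ η p.1).tsum_add (summable_ultraweak ξ η p.2)).symm
  · refine continuous_ultraweak_rng fun ξ η => ?_
    refine (ultraweak_functional_continuous (ampApply (ContinuousLinearMap.adjoint A) ξ) η).congr
      fun T => tsum_congr fun n => ?_
    exact ContinuousLinearMap.adjoint_inner_left A (T (η n)) (ξ n)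
  · refine continuous_ultraweak_rng fun ξ η => ?_
    exact ultraweak_functional_continuous ξ (ampApply A η)

theorem ultraweak_continuousStar : @ContinuousStar (H →L[ℂ] H) (ultraweak H) _ := by
  let _ : TopologicalSpace (H →L[ℂ] H) := ultraweak H
  refine ⟨continuous_ultraweak_rng fun ξ η => ?_⟩
  refine (Complex.continuous_conj.comp (ultraweak_functional_continuous η ξ)).congr fun T => ?_
  simp only [Function.comp_apply, Complex.conj_tsum, inner_conj_symm]
  exact tsum_congr fun n => (ContinuousLinearMap.adjoint_inner_right T (ξ n) (η n)).symm

/-- The relative weak* topology of a star subalgebra of `B(H)`. -/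
@[reducible]
def StarSubalgebra.ultraweak (S : StarSubalgebra ℂ (H →L[ℂ] H)) : TopologicalSpace S :=
  TopologicalSpace.induced Subtype.val (_root_.ultraweak H)

/-- The predual of a von Neumann algebra `S ⊆ B(H)`: the normal (that is, weak* continuous) linear
functionals on `S`, with the norm of the dual Banach space of `S`. -/
def StarSubalgebra.predual (S : StarSubalgebra ℂ (H →L[ℂ] H)) : Submodule ℂ (StrongDual ℂ S) where
  carrier := {φ | Continuous[S.ultraweak, inferInstance] φ}
  add_mem' {φ ψ} hφ hψ := by
    let _ := S.ultraweak
    exact Continuous.add (f := fun T => φ T) (g := fun T => ψ T) hφ hψ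
  zero_mem' := by
    let _ := S.ultraweak
    exact continuous_const (y := (0 : ℂ))
  smul_mem' c φ hφ := by
    let _ := S.ultraweak
    exact Continuous.const_smul (g := fun T => φ T) hφ c

/-- A star homomorphism between von Neumann algebras is normal if it is weak* continuous. -/
def IsNormalHom {K : Type*} [NormedAddCommGroup K] [InnerProductSpace ℂ K] [CompleteSpace K]
    {S : StarSubalgebra ℂ (H →L[ℂ] H)} {T : StarSubalgebra ℂ (K →L[ℂ] K)}
    (Φ : S →⋆ₐ[ℂ] T) : Prop :=
  Continuous[S.ultraweak, T.ultraweak] Φ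

/-- A star representation of a von Neumann algebra is normal if it is weak* continuous. -/
def IsNormalRep {K : Type*} [NormedAddCommGroup K] [InnerProductSpace ℂ K] [CompleteSpace K]
    {S : StarSubalgebra ℂ (H →L[ℂ] H)} (π : S →⋆ₐ[ℂ] (K →L[ℂ] K)) : Prop :=
  Continuous[S.ultraweak, _root_.ultraweak K] π

end Ultraweak

/-! ### Weak* tensor products -/

section WeakStarTensor

variable {M N : Type*}
  [Ring M] [StarRing M] [Algebra ℂ M] [StarModule ℂ M] [TopologicalSpace M]
  [Ring N] [StarRing N] [Algebra ℂ N] [StarModule ℂ N] [TopologicalSpace N]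
  {H : Type*} [NormedAddCommGroup H] [InnerProductSpace ℂ H] [CompleteSpace H]

/-- `α` defines a weak* tensor product of the von Neumann algebras `M` and `N` (which carry their
weak* topologies): it is an injective star representation of the algebraic tensor product `M ⊙ N`
on a Hilbert space whose restrictions to `M ⊗ 1` and `1 ⊗ N` are weak* homeomorphisms onto their
ranges. -/
structure IsWeakStarTensor (α : (M ⊗[ℂ] N) →⋆ₐ[ℂ] (H →L[ℂ] H)) : Prop where
  injective : Function.Injective α
  left : @Topology.IsEmbedding _ _ _ (ultraweak H) (fun a : M => α (a ⊗ₜ[ℂ] (1 : N)))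
  right : @Topology.IsEmbedding _ _ _ (ultraweak H) (fun b : N => α ((1 : M) ⊗ₜ[ℂ] b))

/-- The von Neumann algebra `M ⊗̄_α N`: the weak* closure of `α(M ⊙ N)` in `B(H)`. -/
def weakStarTensor (α : (M ⊗[ℂ] N) →⋆ₐ[ℂ] (H →L[ℂ] H)) : StarSubalgebra ℂ (H →L[ℂ] H) :=
  letI : TopologicalSpace (H →L[ℂ] H) := ultraweak H
  haveI : IsSemitopologicalSemiring (H →L[ℂ] H) := ultraweak_semitopological
  haveI : ContinuousStar (H →L[ℂ] H) := ultraweak_continuousStar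
  α.range.topologicalClosure

theorem coe_weakStarTensor (α : (M ⊗[ℂ] N) →⋆ₐ[ℂ] (H →L[ℂ] H)) :
    (weakStarTensor α : Set (H →L[ℂ] H)) = @closure _ (ultraweak H) (Set.range α) := rfl

/-- The canonical map `α : M ⊙ N → M ⊗̄_α N`. -/
def toWeakStarTensor (α : (M ⊗[ℂ] N) →⋆ₐ[ℂ] (H →L[ℂ] H)) (t : M ⊗[ℂ] N) : weakStarTensor α :=
  ⟨α t, @subset_closure _ (ultraweak H) (Set.range α) _ ⟨t, rfl⟩⟩

/-- `M ⊗̄_α N` is the maximal weak* tensor product: it is a weak* tensor product, and for every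
weak* tensor product `M ⊗̄_β N` the identity map of `M ⊙ N` extends to a normal star homomorphism
`M ⊗̄_α N → M ⊗̄_β N`.  (Such a homomorphism is automatically onto, because the image of a normal
star homomorphism is weak* closed.)  The Hilbert spaces `K` range over a universe `v` that need not be
that of `H`. For `M, N : Type` the choice `v = 0` tests against everything: every representation of
`M ⊙ N` is a direct sum of cyclic ones, and these are unitarily equivalent to ones in `Type`. -/
structure IsMaximalWeakStarTensor.{u₁, u₂, u, v}
    {M : Type u₁} [Ring M] [StarRing M] [Algebra ℂ M] [StarModule ℂ M] [TopologicalSpace M]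
    {N : Type u₂} [Ring N] [StarRing N] [Algebra ℂ N] [StarModule ℂ N] [TopologicalSpace N]
    {H : Type u} [NormedAddCommGroup H] [InnerProductSpace ℂ H] [CompleteSpace H]
    (α : (M ⊗[ℂ] N) →⋆ₐ[ℂ] (H →L[ℂ] H)) : Prop where
  isWeakStarTensor : IsWeakStarTensor α
  exists_extension : ∀ (K : Type v) [NormedAddCommGroup K] [InnerProductSpace ℂ K]
    [CompleteSpace K] (β : (M ⊗[ℂ] N) →⋆ₐ[ℂ] (K →L[ℂ] K)), IsWeakStarTensor β →
    ∃ Φ : weakStarTensor α →⋆ₐ[ℂ] weakStarTensor β,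
      IsNormalHom Φ ∧ ∀ t, Φ (toWeakStarTensor α t) = toWeakStarTensor β t

end WeakStarTensor

/-! ### The measures `μ_x` -/

/-- The measure `μ_x` on `ℝ × ℝ` with `∫ f dμ_x = ∫ f(y, x + y) dy`. -/
def lineMeasure (x : ℝ) : Measure (ℝ × ℝ) := Measure.map (fun y : ℝ => (y, x + y)) volume

theorem measurableSet_lineBox (x : ℝ) :
    MeasurableSet (Set.Icc (0 : ℝ) 1 ×ˢ Set.Icc x (1 + x)) :=
  measurableSet_Icc.prod measurableSet_Icc

theorem lineMeasure_lineBox_ne_top (x : ℝ) :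
    lineMeasure x (Set.Icc (0 : ℝ) 1 ×ˢ Set.Icc x (1 + x)) ≠ ∞ := by
  rw [lineMeasure, Measure.map_apply (by fun_prop) (measurableSet_lineBox x)]
  refine ne_top_of_le_ne_top (b := volume (Set.Icc (0 : ℝ) 1)) (by simp) (measure_mono ?_)
  intro y hy
  exact hy.1

/-- The vector `ξ_x ∈ L²(μ_x)`: the characteristic function of `[0, 1] × [x, 1 + x]`. -/
def lineVector (x : ℝ) : Lp ℂ 2 (lineMeasure x) :=
  indicatorConstLp 2 (measurableSet_lineBox x) (lineMeasure_lineBox_ne_top x) (1 : ℂ)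

end

/-! ### Weak* continuous functionals on `L^∞` -/

namespace LInf

variable {X : Type*} [MeasurableSpace X] {μ : Measure X}

/-! The measure `μ_x` lives on the line `t = x + s`, and both coordinate projections carry it to
Lebesgue measure. Hence `f ⊗ g ↦ f(s)g(t)` on `L²(μ_x)` is well defined and normal in each variable.
It is not injective on `A ⊙ A`, so maximality does not apply to it directly. The remedy is to add
the planar representation on `L²(ℝ²)`, which is a weak* tensor product. In the direct sum of the two
kinds of representation, injectivity and the embedding property come from the planar summand alone,
while continuity needs only normality of every summand (`isWeakStarTensor_tensorDirectSum`).
Maximality maps `S` normally to the algebra of the sum. Compression to a summand is a normal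
homomorphism (`exists_compress_hom`), and this gives the representation of `S` on `L²(μ_x)` and its
vector functional `φ_x`.

To separate `φ_x` from `φ_y`, cut `[0, 1)` into `n` intervals `I_k` and take the projection `∑
χ(I_k) ⊗ χ(x + I_k)` in `A ⊙ A`. The boxes `I_k × (x + I_k)` cover the part of the line `t = x + s`
over `[0, 1)`, and they miss the line `t = y + s` once `1/n ≤ |x - y|`. So `φ_x - φ_y` takes the
value `1` on an element of norm at most `1`, and an uncountable family with mutual distances at
least `1` excludes separability.

A maximal product is the direct sum of all weak* tensor products on spaces in `Type`. Arbitrarily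
large sums stay normal on `L^∞` because a vector functional of the sum is an absolutely convergent
series of functionals in `L¹`, which is complete (`LInf.continuous_tsum_functional`). -/

theorem memLp (f : LInf μ) : MemLp f ∞ μ := Lp.memLp (f : Lp ℂ ∞ μ)

/-- The class of an essentially bounded function. -/
noncomputable def mk (g : X → ℂ) (hg : MemLp g ∞ μ) : LInf μ := hg.toLp

theorem coeFn_mk (g : X → ℂ) (hg : MemLp g ∞ μ) : ⇑(mk g hg) =ᵐ[μ] g := MemLp.coeFn_toLp hg

theorem ae_norm_le (f : LInf μ) : ∃ C : ℝ, 0 ≤ C ∧ ∀ᵐ x ∂μ, ‖f x‖ ≤ C := by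
  refine ⟨(eLpNormEssSup f μ).toReal, ENNReal.toReal_nonneg, ?_⟩
  have hf : eLpNormEssSup f μ ≠ ∞ := by
    simpa [eLpNorm_exponent_top] using f.memLp.eLpNorm_ne_top
  filter_upwards [enorm_ae_le_eLpNormEssSup (⇑f) μ] with x hx
  simpa using ENNReal.toReal_mono hf hx

theorem integrable_mul (f : LInf μ) (h : Lp ℂ 1 μ) : Integrable (fun x => f x * h x) μ := by
  obtain ⟨C, -, hC⟩ := f.ae_norm_le
  exact (L1.integrable_coeFn h).bdd_mul f.memLp.aestronglyMeasurable hC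

/-- The functional `f ↦ ∫ f h ∂μ`. -/
noncomputable def pairing (h : Lp ℂ 1 μ) : LInf μ →ₗ[ℂ] ℂ where
  toFun f := ∫ x, f x * h x ∂μ
  map_add' f g := by
    rw [← integral_add (integrable_mul f h) (integrable_mul g h)]
    refine integral_congr_ae ?_
    filter_upwards [coeFn_add f g] with x hx
    rw [hx, add_mul]
  map_smul' c f := by
    rw [RingHom.id_apply, smul_eq_mul, ← integral_const_mul]
    refine integral_congr_ae ?_
    filter_upwards [coeFn_smul c f] with x hx
    rw [hx, mul_assoc]

theorem pairing_apply (h : Lp ℂ 1 μ) (f : LInf μ) : pairing h f = ∫ x, f x * h x ∂μ := rfl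

theorem continuous_pairing (h : Lp ℂ 1 μ) : Continuous (pairing h) :=
  continuous_iff_le_induced.2 (iInf_le _ h)

/-- The underlying element of `Lp ℂ ∞ μ`. -/
noncomputable def toLp (f : LInf μ) : Lp ℂ ∞ μ := f

theorem pairing_eq_lpPairing (h : Lp ℂ 1 μ) (f : LInf μ) :
    pairing h f = (ContinuousLinearMap.mul ℂ ℂ).lpPairing μ ∞ 1 (toLp f) h := by
  rw [ContinuousLinearMap.lpPairing_eq_integral]
  rfl

/-- A linear functional continuous for the topology induced by a family of functionals lies in the
span of the family. The pairings already form a subspace, since they are linear in `h`. -/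
theorem exists_eq_pairing (φ : LInf μ →ₗ[ℂ] ℂ) (hφ : Continuous φ) :
    ∃ h : Lp ℂ 1 μ, φ = pairing h := by
  have hmem : φ ∈ Submodule.span ℂ (Set.range (pairing (μ := μ))) :=
    (LinearMap.mem_span_iff_continuous (f := pairing (μ := μ)) φ).2 hφ
  clear hφ
  induction hmem using Submodule.span_induction with
  | mem φ h => obtain ⟨h, rfl⟩ := h; exact ⟨h, rfl⟩
  | zero => exact ⟨0, by ext f; simp [pairing_eq_lpPairing]⟩
  | add φ ψ _ _ ihφ ihψ =>
    obtain ⟨h, rfl⟩ := ihφ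
    obtain ⟨k, rfl⟩ := ihψ
    exact ⟨h + k, by ext f; simp [pairing_eq_lpPairing]⟩
  | smul c φ _ ih =>
    obtain ⟨h, rfl⟩ := ih
    exact ⟨c • h, by ext f; simp [pairing_eq_lpPairing]⟩

/-- The `L¹` norm is attained at the phase `conj h / |h|`, set to `1` where `h` vanishes so that it
is unitary. Bounds on functionals therefore need checking on unitaries only, which star
representations send to isometries. -/
theorem exists_unitary_pairing_eq_norm (h : Lp ℂ 1 μ) :
    ∃ u : LInf μ, star u * u = 1 ∧ pairing h u = ‖h‖ := by
  have hm : StronglyMeasurable h := Lp.stronglyMeasurable h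
  let g : X → ℂ := fun x => if h x = 0 then 1 else star (h x) / ‖h x‖
  have hg1 : ∀ x, star (g x) * g x = 1 := by
    intro x
    by_cases hx : h x = 0
    · simp [g, hx]
    · have h0 : (‖h x‖ : ℂ) ≠ 0 := by simpa using hx
      simp only [g, if_neg hx, star_div₀, RCLike.star_def, Complex.conj_ofReal,
        Complex.conj_conj]
      rw [div_mul_div_comm, Complex.mul_conj, Complex.normSq_eq_norm_sq]
      push_cast
      rw [← sq]
      exact div_self (pow_ne_zero 2 h0)
  have hg2 : ∀ x, g x * h x = ‖h x‖ := by
    intro x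
    by_cases hx : h x = 0
    · simp [g, hx]
    · have h0 : (‖h x‖ : ℂ) ≠ 0 := by simpa using hx
      simp only [g, if_neg hx]
      rw [div_mul_eq_mul_div, RCLike.star_def, mul_comm, Complex.mul_conj,
        Complex.normSq_eq_norm_sq]
      push_cast
      rw [sq, mul_div_assoc, div_self h0, mul_one]
  have hgm : Measurable g := by
    have hm' := hm.measurable
    refine Measurable.ite (hm' (measurableSet_singleton 0)) measurable_const ?_
    fun_prop
  have hgn : ∀ x, ‖g x‖ ≤ 1 := by
    intro x
    have := congrArg norm (hg1 x)
    rw [norm_mul, norm_star, norm_one] at this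
    nlinarith [norm_nonneg (g x)]
  have hg : MemLp g ∞ μ := memLp_top_of_bound hgm.aestronglyMeasurable 1 (.of_forall hgn)
  refine ⟨mk g hg, ext ?_, ?_⟩
  · filter_upwards [coeFn_mul (star (mk g hg)) (mk g hg), coeFn_star (mk g hg), coeFn_mk g hg,
      coeFn_one (μ := μ)] with x h1 h2 h3 h4
    rw [h1, h2, h3, h4, hg1]
  · rw [pairing_apply, L1.norm_eq_integral_norm, ← integral_complex_ofReal]
    refine integral_congr_ae ?_
    filter_upwards [coeFn_mk g hg] with x hx
    rw [hx, hg2]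

/-- An absolutely convergent series of weak* continuous functionals is weak* continuous. -/
theorem continuous_tsum_functional {ι : Type*} (ω : ι → LInf μ →ₗ[ℂ] ℂ)
    (hω : ∀ i, Continuous (ω i)) (c : ι → ℝ) (hc : Summable c)
    (hle : ∀ i u, star u * u = 1 → ‖ω i u‖ ≤ c i) :
    Continuous fun f => ∑' i, ω i f := by
  -- Tested on the unitary phase of its density, each bound becomes `‖h i‖ ≤ c i`, so the densities
  -- are summable in `L¹`, and their sum represents the series.
  choose h hh using fun i => exists_eq_pairing (ω i) (hω i)
  have hn : ∀ i, ‖h i‖ ≤ c i := by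
    intro i
    obtain ⟨u, hu, hu'⟩ := exists_unitary_pairing_eq_norm (h i)
    have := hle i u hu
    rw [hh i, hu'] at this
    simpa using this
  have hs : Summable h := Summable.of_norm_bounded hc hn
  refine (continuous_pairing (∑' i, h i)).congr fun f => ?_
  rw [pairing_eq_lpPairing, ContinuousLinearMap.map_tsum _ hs]
  refine tsum_congr fun i => ?_
  rw [hh i, pairing_eq_lpPairing]

/-- Take `g = √(C² - |f|²)`. The identity is algebraic, so it survives every star representation and
bounds the image of `f` by `C` without any continuity. -/
theorem exists_star_mul_add (f : LInf μ) :
    ∃ C : ℝ, 0 ≤ C ∧ ∃ g : LInf μ, star f * f + star g * g = ((C ^ 2 : ℝ) : ℂ) • 1 := by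
  obtain ⟨C, hC, hf⟩ := f.ae_norm_le
  have hfm : StronglyMeasurable f := Lp.stronglyMeasurable (toLp f)
  let k : X → ℂ := fun x => (Real.sqrt (C ^ 2 - ‖f x‖ ^ 2) : ℝ)
  have hkm : Measurable k := by
    have := hfm.measurable
    fun_prop
  have hk : MemLp k ∞ μ := by
    refine memLp_top_of_bound hkm.aestronglyMeasurable C (.of_forall fun x => ?_)
    rw [Complex.norm_real, Real.norm_of_nonneg (Real.sqrt_nonneg _)]
    exact Real.sqrt_le_iff.2 ⟨hC, by nlinarith [norm_nonneg (f x)]⟩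
  refine ⟨C, hC, mk k hk, ext ?_⟩
  filter_upwards [coeFn_add (star f * f) (star (mk k hk) * mk k hk), coeFn_mul (star f) f,
    coeFn_star f, coeFn_mul (star (mk k hk)) (mk k hk), coeFn_star (mk k hk), coeFn_mk k hk,
    coeFn_smul ((C ^ 2 : ℝ) : ℂ) (1 : LInf μ), coeFn_one (μ := μ), hf]
    with x h1 h2 h3 h4 h5 h6 h7 h8 h9
  rw [h1, h2, h3, h4, h5, h6, h7, h8, mul_one]
  simp only [RCLike.star_def, k, Complex.conj_ofReal]
  rw [mul_comm, Complex.mul_conj, Complex.normSq_eq_norm_sq, ← Complex.ofReal_mul,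
    ← Complex.ofReal_add, Real.mul_self_sqrt]
  · congr 1; ring
  · nlinarith [norm_nonneg (f x)]

end LInf

/-! ### Star representations of `L^∞` -/

section Representations

variable {X : Type*} [MeasurableSpace X] {μ : Measure X}
  {H : Type*} [NormedAddCommGroup H] [InnerProductSpace ℂ H] [CompleteSpace H]

theorem norm_map_apply_sq {A : Type*} [Ring A] [StarRing A] [Algebra ℂ A]
    (π : A →⋆ₐ[ℂ] (H →L[ℂ] H)) (f : A) (ξ : H) :
    ((‖π f ξ‖ ^ 2 : ℝ) : ℂ) = ⟪ξ, π (star f * f) ξ⟫_ℂ := by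
  rw [map_mul, map_star, ContinuousLinearMap.star_eq_adjoint, mul_apply_eq_comp,
    ContinuousLinearMap.adjoint_inner_right, inner_self_eq_norm_sq_to_K]
  push_cast
  rfl

theorem norm_map_of_star_mul_self_eq_one {A : Type*} [Ring A] [StarRing A] [Algebra ℂ A]
    (π : A →⋆ₐ[ℂ] (H →L[ℂ] H)) {u : A} (hu : star u * u = 1) (ξ : H) : ‖π u ξ‖ = ‖ξ‖ := by
  have h := norm_map_apply_sq π u ξ
  rw [hu, map_one, one_apply_eq_self, inner_self_eq_norm_sq_to_K] at h
  have h' : ‖π u ξ‖ ^ 2 = ‖ξ‖ ^ 2 := by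
    refine Complex.ofReal_injective (h.trans ?_)
    push_cast
    rfl
  exact (sq_eq_sq₀ (norm_nonneg _) (norm_nonneg _)).1 h'

/-- A bound for the image of `f` that is uniform in the representation. -/
theorem LInf.exists_norm_map_le.{w} (f : LInf μ) :
    ∃ C : ℝ, 0 ≤ C ∧ ∀ (H : Type w) [NormedAddCommGroup H] [InnerProductSpace ℂ H]
      [CompleteSpace H] (π : LInf μ →⋆ₐ[ℂ] (H →L[ℂ] H)), ‖π f‖ ≤ C := by
  obtain ⟨C, hC, g, hg⟩ := f.exists_star_mul_add
  refine ⟨C, hC, fun H _ _ _ π => ContinuousLinearMap.opNorm_le_bound _ hC fun ξ => ?_⟩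
  have h : ((‖π f ξ‖ ^ 2 + ‖π g ξ‖ ^ 2 : ℝ) : ℂ) = ((C ^ 2 * ‖ξ‖ ^ 2 : ℝ) : ℂ) := by
    rw [Complex.ofReal_add, norm_map_apply_sq, norm_map_apply_sq, ← inner_add_right,
      ← add_apply, ← map_add, hg, map_smul, map_one, smul_apply,
      one_apply_eq_self, inner_smul_right, inner_self_eq_norm_sq_to_K]
    push_cast
    rfl
  have h' := Complex.ofReal_injective h
  refine le_of_sq_le_sq ?_ (by positivity)
  rw [mul_pow, ← h']
  exact le_add_of_nonneg_right (by positivity)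

theorem summable_norm_mul_norm {ι : Type*} {K : ι → Type*} [∀ i, NormedAddCommGroup (K i)]
    (ξ η : lp K 2) : Summable fun i => ‖ξ i‖ * ‖η i‖ :=
  lp.summable_mul (p := 2) (q := 2) (by norm_num [Real.holderConjugate_iff]) ξ η

/-- A star representation of `L^∞` is weak* continuous if its vector functionals are. -/
theorem LInf.continuous_ultraweak_of_vector (π : LInf μ →⋆ₐ[ℂ] (H →L[ℂ] H))
    (h : ∀ ξ η : H, Continuous fun f => ⟪ξ, π f η⟫_ℂ) :
    Continuous[inferInstance, ultraweak H] π := by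
  refine continuous_ultraweak_rng fun ξ η => ?_
  let ω : ℕ → LInf μ →ₗ[ℂ] ℂ := fun n =>
    { toFun := fun f => ⟪ξ n, π f (η n)⟫_ℂ
      map_add' := fun f g => by rw [map_add, add_apply, inner_add_right]
      map_smul' := fun c f => by
        rw [map_smul, smul_apply, inner_smul_right]; rfl }
  refine LInf.continuous_tsum_functional ω (fun n => h _ _) _ (summable_norm_mul_norm ξ η) ?_
  intro n u hu
  refine (norm_inner_le_norm _ _).trans_eq ?_
  rw [norm_map_of_star_mul_self_eq_one π hu]

/-- Conversely, vector functionals of ultraweakly continuous maps are continuous. -/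
theorem continuous_inner_ultraweak (ξ η : H) :
    Continuous[ultraweak H, inferInstance] fun T : H →L[ℂ] H => ⟪ξ, T η⟫_ℂ := by
  have h : (fun T : H →L[ℂ] H => ⟪ξ, T η⟫_ℂ) = fun T : H →L[ℂ] H =>
      ∑' n, ⟪(lp.single 2 0 ξ : lp (fun _ : ℕ => H) 2) n,
        T ((lp.single 2 0 η : lp (fun _ : ℕ => H) 2) n)⟫_ℂ := by
    funext T
    rw [tsum_eq_single 0 fun n hn => by simp [hn]]
    simp
  rw [h]
  exact ultraweak_functional_continuous _ _

end Representations

/-! ### Compressions -/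

section Compression

variable {H : Type*} [NormedAddCommGroup H] [InnerProductSpace ℂ H] [CompleteSpace H]
  {K : Type*} [NormedAddCommGroup K] [InnerProductSpace ℂ K] [CompleteSpace K]

/-- The map `T ↦ W* T W`. -/
noncomputable def compress (W : K →L[ℂ] H) (T : H →L[ℂ] H) : K →L[ℂ] K :=
  ContinuousLinearMap.adjoint W ∘L T ∘L W

theorem compress_apply (W : K →L[ℂ] H) (T : H →L[ℂ] H) (k : K) :
    compress W T k = ContinuousLinearMap.adjoint W (T (W k)) := rfl

/-- Moving `W` across the inner product turns the functional of `(ξₙ), (ηₙ)` into that of `(W ξₙ),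
(W ηₙ)`. -/
theorem continuous_compress (W : K →L[ℂ] H) :
    Continuous[ultraweak H, ultraweak K] (compress W) := by
  refine @continuous_ultraweak_rng K _ _ _ _ (ultraweak H) _ fun ξ η => ?_
  have h : (fun T : H →L[ℂ] H => ∑' n, ⟪ξ n, compress W T (η n)⟫_ℂ) = fun T : H →L[ℂ] H =>
      ∑' n, ⟪lp.mapCLM 2 (fun _ : ℕ => W) (norm_nonneg W) (fun _ => le_rfl) ξ n,
        T (lp.mapCLM 2 (fun _ : ℕ => W) (norm_nonneg W) (fun _ => le_rfl) η n)⟫_ℂ := by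
    funext T
    refine tsum_congr fun n => ?_
    rw [compress_apply, ContinuousLinearMap.adjoint_inner_right]
    rfl
  rw [h]
  exact ultraweak_functional_continuous _ _

variable {M N : Type*}
  [Ring M] [StarRing M] [Algebra ℂ M] [StarModule ℂ M]
  [Ring N] [StarRing N] [Algebra ℂ N] [StarModule ℂ N]

/-- The range of `W` is invariant under the image of `α`. Written with inner products, invariance is
a weak* closed condition, so it passes to the closure. This is what makes compression by `W`
multiplicative there. -/
theorem proj_apply_of_mem_weakStarTensor {α : (M ⊗[ℂ] N) →⋆ₐ[ℂ] (H →L[ℂ] H)}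
    {β : (M ⊗[ℂ] N) →⋆ₐ[ℂ] (K →L[ℂ] K)} {W : K →L[ℂ] H}
    (hW : ∀ k, ContinuousLinearMap.adjoint W (W k) = k)
    (hα : ∀ t k, α t (W k) = W (β t k)) {T : H →L[ℂ] H} (hT : T ∈ weakStarTensor α) (k : K) :
    W (ContinuousLinearMap.adjoint W (T (W k))) = T (W k) := by
  let s : Set (H →L[ℂ] H) := {T | ∀ ζ k,
    ⟪W (ContinuousLinearMap.adjoint W ζ), T (W k)⟫_ℂ = ⟪ζ, T (W k)⟫_ℂ}
  have hs : IsClosed[ultraweak H] s := by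
    let _ : TopologicalSpace (H →L[ℂ] H) := ultraweak H
    simp only [s, Set.ofPred_forall]
    exact isClosed_iInter fun ζ => isClosed_iInter fun k =>
      isClosed_eq (continuous_inner_ultraweak _ _) (continuous_inner_ultraweak _ _)
  have hsub : (weakStarTensor α : Set (H →L[ℂ] H)) ⊆ s := by
    change @closure _ (ultraweak H) (Set.range α) ⊆ s
    refine @closure_minimal _ (ultraweak H) _ _ ?_ hs
    rintro _ ⟨t, rfl⟩ ζ k
    rw [hα, ← ContinuousLinearMap.adjoint_inner_right, hW,
      ContinuousLinearMap.adjoint_inner_left]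
  refine ext_inner_left ℂ fun ζ => ?_
  rw [← hsub hT ζ k, ← ContinuousLinearMap.adjoint_inner_left,
    ContinuousLinearMap.adjoint_inner_right]

theorem compress_mem_weakStarTensor {α : (M ⊗[ℂ] N) →⋆ₐ[ℂ] (H →L[ℂ] H)}
    {β : (M ⊗[ℂ] N) →⋆ₐ[ℂ] (K →L[ℂ] K)} {W : K →L[ℂ] H} (hαβ : ∀ t, compress W (α t) = β t)
    {T : H →L[ℂ] H} (hT : T ∈ weakStarTensor α) : compress W T ∈ weakStarTensor β := by
  change T ∈ @closure _ (ultraweak H) (Set.range α) at hT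
  change compress W T ∈ @closure _ (ultraweak K) (Set.range β)
  refine @map_mem_closure _ _ (ultraweak H) (ultraweak K) _ _ _ _ (continuous_compress W) hT ?_
  rintro _ ⟨t, rfl⟩
  exact ⟨t, (hαβ t).symm⟩

/-- If an isometry intertwines `β` and `α`, then compression by it is a normal star homomorphism
between the generated von Neumann algebras. -/
theorem exists_compress_hom (α : (M ⊗[ℂ] N) →⋆ₐ[ℂ] (H →L[ℂ] H))
    (β : (M ⊗[ℂ] N) →⋆ₐ[ℂ] (K →L[ℂ] K)) (W : K →L[ℂ] H)
    (hW : ∀ k, ContinuousLinearMap.adjoint W (W k) = k)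
    (hα : ∀ t k, α t (W k) = W (β t k)) :
    ∃ Φ : weakStarTensor α →⋆ₐ[ℂ] weakStarTensor β,
      IsNormalHom Φ ∧ ∀ t, Φ (toWeakStarTensor α t) = toWeakStarTensor β t := by
  have hαβ : ∀ t, compress W (α t) = β t := fun t => by
    ext k
    rw [compress_apply, hα, hW]
  refine ⟨{ toFun := fun T => ⟨compress W T, compress_mem_weakStarTensor hαβ T.2⟩
            map_one' := ?_, map_mul' := ?_, map_zero' := ?_, map_add' := ?_, commutes' := ?_
            map_star' := ?_ }, ?_, ?_⟩
  · refine Subtype.ext (ContinuousLinearMap.ext fun k => ?_)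
    exact hW k
  · intro S T
    refine Subtype.ext (ContinuousLinearMap.ext fun k => ?_)
    change ContinuousLinearMap.adjoint W (S.1 (T.1 (W k))) =
      ContinuousLinearMap.adjoint W (S.1 (W (ContinuousLinearMap.adjoint W (T.1 (W k)))))
    rw [proj_apply_of_mem_weakStarTensor hW hα T.2]
  · refine Subtype.ext (ContinuousLinearMap.ext fun k => ?_)
    exact map_zero (ContinuousLinearMap.adjoint W)
  · intro S T
    refine Subtype.ext (ContinuousLinearMap.ext fun k => ?_)
    exact map_add (ContinuousLinearMap.adjoint W) _ _
  · intro c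
    refine Subtype.ext (ContinuousLinearMap.ext fun k => ?_)
    change ContinuousLinearMap.adjoint W (c • W k) = c • k
    rw [map_smul, hW]
  · intro T
    refine Subtype.ext (ContinuousLinearMap.ext fun k => ?_)
    refine ext_inner_left ℂ fun l => ?_
    change ⟪l, ContinuousLinearMap.adjoint W (ContinuousLinearMap.adjoint T.1 (W k))⟫_ℂ =
      ⟪l, ContinuousLinearMap.adjoint (compress W T.1) k⟫_ℂ
    rw [ContinuousLinearMap.adjoint_inner_right, ContinuousLinearMap.adjoint_inner_right,
      ContinuousLinearMap.adjoint_inner_right, compress_apply,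
      ContinuousLinearMap.adjoint_inner_left]
  · refine continuous_induced_rng.2 ?_
    exact @Continuous.comp _ _ _ (weakStarTensor α).ultraweak (ultraweak H) (ultraweak K) _ _
      (continuous_compress W) continuous_induced_dom
  · intro t
    exact Subtype.ext (hαβ t)

end Compression

/-! ### Direct sums of representations -/

section DirectSum

variable {A : Type*} [Ring A] [StarRing A] [Algebra ℂ A]
  {ι : Type*} {K : ι → Type*} [∀ i, NormedAddCommGroup (K i)] [∀ i, InnerProductSpace ℂ (K i)]
  [∀ i, CompleteSpace (K i)]

/-- The direct sum of a pointwise bounded family of star representations. -/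
noncomputable def directSumRep (π : ∀ i, A →⋆ₐ[ℂ] (K i →L[ℂ] K i))
    (hb : ∀ a, ∃ C : ℝ, 0 ≤ C ∧ ∀ i, ‖π i a‖ ≤ C) : A →⋆ₐ[ℂ] (lp K 2 →L[ℂ] lp K 2) where
  toFun a := lp.mapCLM 2 (fun i => π i a) (hb a).choose_spec.1 (hb a).choose_spec.2
  map_one' := by ext ξ i; simp
  map_mul' a b := by ext ξ i; simp
  map_zero' := by ext ξ i; simp
  map_add' a b := by ext ξ i; simp
  commutes' c := by ext ξ i; simp [AlgHomClass.commutes]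
  map_star' a := by
    rw [ContinuousLinearMap.star_eq_adjoint]
    refine (ContinuousLinearMap.eq_adjoint_iff _ _).2 fun ξ η => ?_
    rw [lp.inner_eq_tsum, lp.inner_eq_tsum]
    refine tsum_congr fun i => ?_
    change ⟪π i (star a) (ξ i), η i⟫_ℂ = ⟪ξ i, π i a (η i)⟫_ℂ
    rw [map_star, ContinuousLinearMap.star_eq_adjoint, ContinuousLinearMap.adjoint_inner_left]

theorem directSumRep_apply (π : ∀ i, A →⋆ₐ[ℂ] (K i →L[ℂ] K i))
    (hb : ∀ a, ∃ C : ℝ, 0 ≤ C ∧ ∀ i, ‖π i a‖ ≤ C) (a : A) (ξ : lp K 2) (i : ι) :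
    directSumRep π hb a ξ i = π i a (ξ i) := rfl

open Classical in
/-- The inclusion of a summand. -/
noncomputable def sumIncl (K : ι → Type*) [∀ i, NormedAddCommGroup (K i)]
    [∀ i, InnerProductSpace ℂ (K i)] (i : ι) : K i →L[ℂ] lp K 2 :=
  lp.singleContinuousLinearMap ℂ K 2 i

set_option linter.unusedSectionVars false in
theorem sumIncl_apply_self (i : ι) (k : K i) : sumIncl K i k i = k := by
  classical
  exact lp.single_apply_self 2 i k

theorem adjoint_sumIncl (i : ι) (ξ : lp K 2) :
    ContinuousLinearMap.adjoint (sumIncl K i) ξ = ξ i := by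
  classical
  refine ext_inner_left ℂ fun k => ?_
  rw [ContinuousLinearMap.adjoint_inner_right]
  exact lp.inner_single_left i k ξ

theorem directSumRep_sumIncl (π : ∀ i, A →⋆ₐ[ℂ] (K i →L[ℂ] K i))
    (hb : ∀ a, ∃ C : ℝ, 0 ≤ C ∧ ∀ i, ‖π i a‖ ≤ C) (a : A) (i : ι) (k : K i) :
    directSumRep π hb a (sumIncl K i k) = sumIncl K i (π i a k) := by
  classical
  refine lp.ext (funext fun j => ?_)
  rw [directSumRep_apply]
  by_cases hj : j = i
  · subst hj
    rw [sumIncl_apply_self, sumIncl_apply_self]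
  · have h : ∀ l : K i, sumIncl K i l j = 0 := fun l => lp.single_apply_ne 2 i l hj
    rw [h, h, map_zero]

theorem compress_directSumRep (π : ∀ i, A →⋆ₐ[ℂ] (K i →L[ℂ] K i))
    (hb : ∀ a, ∃ C : ℝ, 0 ≤ C ∧ ∀ i, ‖π i a‖ ≤ C) (a : A) (i : ι) :
    compress (sumIncl K i) (directSumRep π hb a) = π i a := by
  ext k
  rw [compress_apply, adjoint_sumIncl, directSumRep_apply, sumIncl_apply_self]

/-- A vector functional of the sum is the series over `i` of vector functionals of the summands. On
unitaries its terms are bounded by `‖ξ i‖ ‖η i‖`, which is summable for any index type. -/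
theorem LInf.continuous_directSumRep {X : Type*} [MeasurableSpace X] {μ : Measure X}
    (π : ∀ i, LInf μ →⋆ₐ[ℂ] (K i →L[ℂ] K i))
    (hb : ∀ a, ∃ C : ℝ, 0 ≤ C ∧ ∀ i, ‖π i a‖ ≤ C)
    (hπ : ∀ i, Continuous[inferInstance, ultraweak (K i)] (π i)) :
    Continuous[inferInstance, ultraweak (lp K 2)] (directSumRep π hb) := by
  refine LInf.continuous_ultraweak_of_vector _ fun ξ η => ?_
  simp only [lp.inner_eq_tsum, directSumRep_apply]
  let ω : ι → LInf μ →ₗ[ℂ] ℂ := fun i =>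
    { toFun := fun f => ⟪ξ i, π i f (η i)⟫_ℂ
      map_add' := fun f g => by rw [map_add, add_apply, inner_add_right]
      map_smul' := fun c f => by rw [map_smul, smul_apply, inner_smul_right]; rfl }
  refine LInf.continuous_tsum_functional ω (fun i => ?_) _ (summable_norm_mul_norm ξ η) ?_
  · exact @Continuous.comp _ _ _ _ (ultraweak (K i)) _ _ _
      (continuous_inner_ultraweak (ξ i) (η i)) (hπ i)
  · intro n u hu
    refine (norm_inner_le_norm _ _).trans_eq ?_
    rw [norm_map_of_star_mul_self_eq_one _ hu]

end DirectSum

/-! ### Restrictions to the two tensor factors -/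

section TensorRestriction

variable {M N : Type*}
  [Ring M] [StarRing M] [Algebra ℂ M] [StarModule ℂ M]
  [Ring N] [StarRing N] [Algebra ℂ N] [StarModule ℂ N]
  {B : Type*} [Ring B] [StarRing B] [Algebra ℂ B]

/-- The restriction of `α` to `M ⊗ 1`. -/
noncomputable def StarAlgHom.restrictLeft (α : (M ⊗[ℂ] N) →⋆ₐ[ℂ] B) : M →⋆ₐ[ℂ] B :=
  { (α : (M ⊗[ℂ] N) →ₐ[ℂ] B).comp Algebra.TensorProduct.includeLeft with
    map_star' := fun a => by
      change α (star a ⊗ₜ[ℂ] (1 : N)) = star (α (a ⊗ₜ[ℂ] (1 : N)))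
      rw [← map_star, TensorProduct.star_tmul, star_one] }

/-- The restriction of `α` to `1 ⊗ N`. -/
noncomputable def StarAlgHom.restrictRight (α : (M ⊗[ℂ] N) →⋆ₐ[ℂ] B) : N →⋆ₐ[ℂ] B :=
  { (α : (M ⊗[ℂ] N) →ₐ[ℂ] B).comp Algebra.TensorProduct.includeRight with
    map_star' := fun a => by
      change α ((1 : M) ⊗ₜ[ℂ] star a) = star (α ((1 : M) ⊗ₜ[ℂ] a))
      rw [← map_star, TensorProduct.star_tmul, star_one] }

theorem StarAlgHom.restrictLeft_mul_restrictRight (α : (M ⊗[ℂ] N) →⋆ₐ[ℂ] B) (a : M) (b : N) :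
    α.restrictLeft a * α.restrictRight b = α (a ⊗ₜ[ℂ] b) := by
  change α (a ⊗ₜ[ℂ] (1 : N)) * α ((1 : M) ⊗ₜ[ℂ] b) = _
  rw [← map_mul, Algebra.TensorProduct.tmul_mul_tmul, mul_one, one_mul]

variable [TopologicalSpace M] [TopologicalSpace N]
  {H : Type*} [NormedAddCommGroup H] [InnerProductSpace ℂ H] [CompleteSpace H]

theorem IsWeakStarTensor.continuous_restrictLeft {α : (M ⊗[ℂ] N) →⋆ₐ[ℂ] (H →L[ℂ] H)}
    (h : IsWeakStarTensor α) : Continuous[inferInstance, ultraweak H] α.restrictLeft :=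
  @Topology.IsEmbedding.continuous _ _ _ (_) (ultraweak H) h.left

theorem IsWeakStarTensor.continuous_restrictRight {α : (M ⊗[ℂ] N) →⋆ₐ[ℂ] (H →L[ℂ] H)}
    (h : IsWeakStarTensor α) : Continuous[inferInstance, ultraweak H] α.restrictRight :=
  @Topology.IsEmbedding.continuous _ _ _ (_) (ultraweak H) h.right

theorem isEmbedding_of_continuous_comp {X Y Z : Type*} {tX : TopologicalSpace X}
    {tY : TopologicalSpace Y} {tZ : TopologicalSpace Z} {f : X → Y} {g : Y → Z}
    (hf : Continuous[tX, tY] f) (hg : Continuous[tY, tZ] g)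
    (hgf : @Topology.IsEmbedding _ _ tX tZ (g ∘ f)) : @Topology.IsEmbedding _ _ tX tY f :=
  .of_comp hf hg hgf

end TensorRestriction

/-! ### Direct sums of representations of `L^∞ ⊙ L^∞` -/

section TensorDirectSum

variable {X Y : Type*} [MeasurableSpace X] [MeasurableSpace Y] {μ : Measure X} {ν : Measure Y}
  {ι : Type*} {K : ι → Type*} [∀ i, NormedAddCommGroup (K i)] [∀ i, InnerProductSpace ℂ (K i)]
  [∀ i, CompleteSpace (K i)]

/-- The bound is assembled from an expression of `t` by elementary tensors, with the
representation-free bounds for each factor, so it is uniform over the family. -/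
theorem exists_norm_tensor_le (β : ∀ i, (LInf μ ⊗[ℂ] LInf ν) →⋆ₐ[ℂ] (K i →L[ℂ] K i))
    (t : LInf μ ⊗[ℂ] LInf ν) : ∃ C : ℝ, 0 ≤ C ∧ ∀ i, ‖β i t‖ ≤ C := by
  induction t using TensorProduct.induction_on with
  | zero => exact ⟨0, le_rfl, fun i => by simp⟩
  | tmul f g =>
    obtain ⟨C, hC, hf⟩ := f.exists_norm_map_le
    obtain ⟨D, hD, hg⟩ := g.exists_norm_map_le
    refine ⟨C * D, mul_nonneg hC hD, fun i => ?_⟩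
    rw [← StarAlgHom.restrictLeft_mul_restrictRight]
    exact (norm_mul_le _ _).trans
      (mul_le_mul (hf _ _) (hg _ _) (norm_nonneg _) hC)
  | add s t hs ht =>
    obtain ⟨C, hC, hs⟩ := hs
    obtain ⟨D, hD, ht⟩ := ht
    refine ⟨C + D, add_nonneg hC hD, fun i => ?_⟩
    rw [map_add]
    exact (norm_add_le _ _).trans (add_le_add (hs i) (ht i))

/-- The direct sum of a family of star representations of `L^∞(μ) ⊙ L^∞(ν)`. -/
noncomputable def tensorDirectSum (β : ∀ i, (LInf μ ⊗[ℂ] LInf ν) →⋆ₐ[ℂ] (K i →L[ℂ] K i)) :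
    (LInf μ ⊗[ℂ] LInf ν) →⋆ₐ[ℂ] (lp K 2 →L[ℂ] lp K 2) :=
  directSumRep β (exists_norm_tensor_le β)

/-- Compression to the summand `i` recovers `β i` continuously, so injectivity and the embedding
property lift from that summand. The other summands need only normal restrictions. -/
theorem isWeakStarTensor_tensorDirectSum
    (β : ∀ i, (LInf μ ⊗[ℂ] LInf ν) →⋆ₐ[ℂ] (K i →L[ℂ] K i))
    (hl : ∀ i, Continuous[inferInstance, ultraweak (K i)] (β i).restrictLeft)
    (hr : ∀ i, Continuous[inferInstance, ultraweak (K i)] (β i).restrictRight)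
    (i : ι) (hi : IsWeakStarTensor (β i)) : IsWeakStarTensor (tensorDirectSum β) := by
  have hc : ∀ t, compress (sumIncl K i) (tensorDirectSum β t) = β i t := fun t =>
    compress_directSumRep β _ t i
  refine ⟨fun s t hst => hi.injective ?_, ?_, ?_⟩
  · rw [← hc, ← hc, hst]
  · refine isEmbedding_of_continuous_comp
      (LInf.continuous_directSumRep (fun i => (β i).restrictLeft)
        (fun a => exists_norm_tensor_le β _) hl) (continuous_compress (sumIncl K i)) ?_
    convert hi.left using 1
    exact funext fun a => hc _
  · refine isEmbedding_of_continuous_comp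
      (LInf.continuous_directSumRep (fun i => (β i).restrictRight)
        (fun a => exists_norm_tensor_le β _) hr) (continuous_compress (sumIncl K i)) ?_
    convert hi.right using 1
    exact funext fun a => hc _

/-- The coordinate maps of a direct sum are normal star homomorphisms. -/
theorem exists_coordinate_hom (β : ∀ i, (LInf μ ⊗[ℂ] LInf ν) →⋆ₐ[ℂ] (K i →L[ℂ] K i)) (i : ι) :
    ∃ Φ : weakStarTensor (tensorDirectSum β) →⋆ₐ[ℂ] weakStarTensor (β i),
      IsNormalHom Φ ∧ ∀ t, Φ (toWeakStarTensor _ t) = toWeakStarTensor (β i) t :=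
  exists_compress_hom _ _ (sumIncl K i)
    (fun k => by rw [adjoint_sumIncl, sumIncl_apply_self])
    (fun t k => directSumRep_sumIncl β _ t i k)

end TensorDirectSum

/-! ### Existence of a maximal weak* tensor product -/

section Existence

/-- The weak* tensor products in a fixed universe. -/
structure WeakStarTensorRep (M N : Type*)
    [Ring M] [StarRing M] [Algebra ℂ M] [StarModule ℂ M] [TopologicalSpace M]
    [Ring N] [StarRing N] [Algebra ℂ N] [StarModule ℂ N] [TopologicalSpace N] where
  /-- The Hilbert space. -/
  space : Type
  [normed : NormedAddCommGroup space]
  [inner : InnerProductSpace ℂ space]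
  [complete : CompleteSpace space]
  /-- The representation. -/
  rep : (M ⊗[ℂ] N) →⋆ₐ[ℂ] (space →L[ℂ] space)
  isWeakStarTensor : IsWeakStarTensor rep

attribute [instance] WeakStarTensorRep.normed WeakStarTensorRep.inner WeakStarTensorRep.complete

/-- Every competitor `β` is itself one of the summands, and its coordinate map is the required
extension. The given `β₀` guarantees a summand that makes the sum a weak* tensor product. -/
theorem isMaximalWeakStarTensor_tensorDirectSum {X Y : Type} [MeasurableSpace X]
    [MeasurableSpace Y] {μ : Measure X} {ν : Measure Y}
    (β₀ : WeakStarTensorRep (LInf μ) (LInf ν)) :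
    IsMaximalWeakStarTensor.{0, 0, 1, 0}
      (tensorDirectSum fun β : WeakStarTensorRep (LInf μ) (LInf ν) => β.rep) where
  isWeakStarTensor := isWeakStarTensor_tensorDirectSum _
    (fun β => β.isWeakStarTensor.continuous_restrictLeft)
    (fun β => β.isWeakStarTensor.continuous_restrictRight) β₀ β₀.isWeakStarTensor
  exists_extension K _ _ _ β hβ :=
    exists_coordinate_hom (fun β : WeakStarTensorRep (LInf μ) (LInf ν) => β.rep) ⟨K, β, hβ⟩

end Existence

/-! ### Multiplication representations on `L²` -/

namespace LInf

variable {X Y Z : Type*} [MeasurableSpace X] [MeasurableSpace Y] [MeasurableSpace Z]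
  {μ : Measure X} {μ' : Measure Y} {ν : Measure Z}

theorem coeFn_finset_sum {ι : Type*} (s : Finset ι) (f : ι → LInf μ) :
    ⇑(∑ i ∈ s, f i) =ᵐ[μ] fun x => ∑ i ∈ s, f i x := by
  classical
  induction s using Finset.induction_on with
  | empty => simpa using coeFn_zero (μ := μ)
  | insert i s hi ih =>
    rw [Finset.sum_insert hi]
    filter_upwards [coeFn_add (f i) (∑ i ∈ s, f i), ih] with x h1 h2
    rw [h1, h2, Finset.sum_insert hi]

theorem coeFn_algebraMap (c : ℂ) : ⇑(algebraMap ℂ (LInf μ) c) =ᵐ[μ] fun _ => c := by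
  rw [Algebra.algebraMap_eq_smul_one]
  filter_upwards [coeFn_smul c (1 : LInf μ), coeFn_one (μ := μ)] with x h1 h2
  rw [h1, h2, mul_one]

theorem memLp_comp {p : Z → X} (hp : Measure.QuasiMeasurePreserving p ν μ) (f : LInf μ) :
    MemLp (fun z => f (p z)) ∞ ν := by
  obtain ⟨C, -, hC⟩ := f.ae_norm_le
  exact memLp_top_of_bound (f.memLp.aestronglyMeasurable.comp_quasiMeasurePreserving hp) C
    (hp.ae hC)

/-- Composition with a map that does not charge null sets. -/
noncomputable def pullback {p : Z → X} (hp : Measure.QuasiMeasurePreserving p ν μ) :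
    LInf μ →⋆ₐ[ℂ] LInf ν :=
  let F : LInf μ → LInf ν := fun f => mk _ (memLp_comp hp f)
  have hF : ∀ f, ⇑(F f) =ᵐ[ν] fun z => f (p z) := fun f => coeFn_mk _ (memLp_comp hp f)
  { toFun := F
    map_one' := ext <| by
      filter_upwards [hF 1, hp.ae (coeFn_one (μ := μ)), coeFn_one (μ := ν)] with z h1 h2 h3
      rw [h1, h2, h3]
    map_mul' := fun f g => ext <| by
      filter_upwards [hF (f * g), hp.ae (coeFn_mul f g), coeFn_mul (F f) (F g), hF f, hF g]
        with z h1 h2 h3 h4 h5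
      rw [h1, h2, h3, h4, h5]
    map_zero' := ext <| by
      filter_upwards [hF 0, hp.ae (coeFn_zero (μ := μ)), coeFn_zero (μ := ν)] with z h1 h2 h3
      rw [h1, h2, h3]
    map_add' := fun f g => ext <| by
      filter_upwards [hF (f + g), hp.ae (coeFn_add f g), coeFn_add (F f) (F g), hF f, hF g]
        with z h1 h2 h3 h4 h5
      rw [h1, h2, h3, h4, h5]
    commutes' := fun c => ext <| by
      filter_upwards [hF (algebraMap ℂ _ c), hp.ae (coeFn_algebraMap (μ := μ) c),
        coeFn_algebraMap (μ := ν) c] with z h1 h2 h3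
      rw [h1, h2, h3]
    map_star' := fun f => ext <| by
      filter_upwards [hF (star f), hp.ae (coeFn_star f), coeFn_star (F f), hF f]
        with z h1 h2 h3 h4
      rw [h1, h2, h3, h4] }

theorem coeFn_pullback {p : Z → X} (hp : Measure.QuasiMeasurePreserving p ν μ) (f : LInf μ) :
    ⇑(pullback hp f) =ᵐ[ν] fun z => f (p z) :=
  coeFn_mk _ (memLp_comp hp f)

/-- The multiplication representation of `L^∞(ν)` on `L²(ν)`. -/
noncomputable def mulRep (ν : Measure Z) : LInf ν →⋆ₐ[ℂ] (Lp ℂ 2 ν →L[ℂ] Lp ℂ 2 ν) :=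
  let F : LInf ν → (Lp ℂ 2 ν →L[ℂ] Lp ℂ 2 ν) := fun f =>
    (ContinuousLinearMap.mul ℂ ℂ).holderL ν ∞ 2 2 (toLp f)
  have hF : ∀ f ξ, ⇑(F f ξ) =ᵐ[ν] fun z => f z * ξ z := fun f ξ =>
    (ContinuousLinearMap.mul ℂ ℂ).coeFn_holder (toLp f) ξ
  { toFun := F
    map_one' := by
      refine ContinuousLinearMap.ext fun ξ => Lp.ext ?_
      filter_upwards [hF 1 ξ, coeFn_one (μ := ν)] with z h1 h2
      rw [h1, h2, one_mul]
      rfl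
    map_mul' := fun f g => by
      refine ContinuousLinearMap.ext fun ξ => Lp.ext ?_
      filter_upwards [hF (f * g) ξ, coeFn_mul f g, hF f (F g ξ), hF g ξ] with z h1 h2 h3 h4
      rw [h1, h2, mul_apply_eq_comp, h3, h4, mul_assoc]
    map_zero' := map_zero ((ContinuousLinearMap.mul ℂ ℂ).holderL ν ∞ 2 2)
    map_add' := fun f g => map_add ((ContinuousLinearMap.mul ℂ ℂ).holderL ν ∞ 2 2) _ _
    commutes' := fun c => by
      refine ContinuousLinearMap.ext fun ξ => Lp.ext ?_
      filter_upwards [hF (algebraMap ℂ _ c) ξ, coeFn_algebraMap (μ := ν) c, Lp.coeFn_smul c ξ]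
        with z h1 h2 h3
      rw [h1, h2]
      exact h3.symm
    map_star' := fun f => by
      rw [ContinuousLinearMap.star_eq_adjoint]
      refine (ContinuousLinearMap.eq_adjoint_iff _ _).2 fun ξ η => ?_
      rw [L2.inner_def, L2.inner_def]
      refine integral_congr_ae ?_
      filter_upwards [hF (star f) ξ, coeFn_star f, hF f η] with z h1 h2 h3
      rw [h1, h2, h3]
      simp only [RCLike.inner_apply, map_mul, RCLike.star_def, Complex.conj_conj]
      ring }

theorem coeFn_mulRep (f : LInf ν) (ξ : Lp ℂ 2 ν) :
    ⇑(mulRep ν f ξ) =ᵐ[ν] fun z => f z * ξ z :=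
  (ContinuousLinearMap.mul ℂ ℂ).coeFn_holder (toLp f) ξ

/-- A σ-finite measure admits a nowhere vanishing `w` in `L²`, and `f w = 0` forces `f = 0`. -/
theorem mulRep_injective [SigmaFinite ν] : Function.Injective (mulRep ν) := by
  rw [injective_iff_map_eq_zero]
  intro f hf
  obtain ⟨g, hg0, hgm, hg⟩ := exists_pos_lintegral_lt_of_sigmaFinite ν one_ne_zero
  let w : Z → ℂ := fun z => (Real.sqrt (g z) : ℝ)
  have hwm : Measurable w := by fun_prop
  have hw : MemLp w 2 ν := by
    rw [memLp_two_iff_integrable_sq_norm hwm.aestronglyMeasurable]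
    have : (fun z => ‖w z‖ ^ 2) = fun z => (g z : ℝ) := by
      funext z
      simp [w, Real.sq_sqrt]
    rw [this]
    refine ⟨by fun_prop, ?_⟩
    rw [hasFiniteIntegral_iff_enorm]
    simpa using hg.trans ENNReal.one_lt_top
  refine ext ?_
  filter_upwards [coeFn_mulRep f (hw.toLp w), hw.coeFn_toLp, coeFn_zero (μ := ν),
    Lp.coeFn_zero ℂ 2 ν] with z h1 h2 h3 h4
  rw [hf, zero_apply, h4, h2] at h1
  rw [h3]
  refine (mul_eq_zero.1 h1.symm).resolve_right ?_
  simpa [w] using (hg0 z).ne'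

theorem inner_mulRep (f : LInf ν) (ξ η : Lp ℂ 2 ν) :
    ⟪ξ, mulRep ν f η⟫_ℂ = ∫ z, f z * (η z * star (ξ z)) ∂ν := by
  rw [L2.inner_def]
  refine integral_congr_ae ?_
  filter_upwards [coeFn_mulRep f η] with z h
  rw [h, RCLike.inner_apply, mul_assoc]
  rfl

/-- The image under `p` of the finite measure `|ξ|² ν` is absolutely continuous with respect to `μ`.
Its Radon–Nikodym derivative is the `L¹` function representing the functional. Equal vectors keep
the measure positive; polarization gives the general case. -/
theorem continuous_inner_mulRep_pullback_self [SigmaFinite μ] {p : Z → X}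
    (hp : Measure.QuasiMeasurePreserving p ν μ) (ξ : Lp ℂ 2 ν) :
    Continuous fun f : LInf μ => ⟪ξ, mulRep ν (pullback hp f) ξ⟫_ℂ := by
  have hξ : Measurable ξ := (Lp.stronglyMeasurable ξ).measurable
  let d : Z → NNReal := fun z => ‖ξ z‖₊ ^ 2
  have hd : Measurable d := by fun_prop
  let m : Measure Z := ν.withDensity fun z => d z
  have hm : IsFiniteMeasure m := by
    refine isFiniteMeasure_withDensity (ne_of_lt ?_)
    have h2 := (memLp_two_iff_integrable_sq_norm (Lp.aestronglyMeasurable ξ)).1 (Lp.memLp ξ)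
    have h3 := h2.2
    rw [hasFiniteIntegral_iff_enorm] at h3
    refine lt_of_eq_of_lt (lintegral_congr fun z => ?_) h3
    simp [d, enorm_eq_nnnorm]
  have hac : m.map p ≪ μ :=
    ((withDensity_absolutelyContinuous ν _).map hp.measurable).trans hp.absolutelyContinuous
  let r : X → ℂ := fun x => (((m.map p).rnDeriv μ x).toReal : ℝ)
  have hr : Integrable r μ := Measure.integrable_toReal_rnDeriv.ofReal
  refine (continuous_pairing hr.toL1).congr fun f => ?_
  have hf : StronglyMeasurable f := Lp.stronglyMeasurable (toLp f)
  calc pairing hr.toL1 f = ∫ x, ((m.map p).rnDeriv μ x).toReal • f x ∂μ := by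
        refine integral_congr_ae ?_
        filter_upwards [hr.coeFn_toL1] with x hx
        rw [hx, mul_comm, Complex.real_smul]
    _ = ∫ x, f x ∂(m.map p) := integral_rnDeriv_smul hac
    _ = ∫ z, f (p z) ∂m := integral_map hp.measurable.aemeasurable hf.aestronglyMeasurable
    _ = ∫ z, d z • f (p z) ∂ν := integral_withDensity_eq_integral_smul hd _
    _ = ⟪ξ, mulRep ν (pullback hp f) ξ⟫_ℂ := by
        rw [inner_mulRep]
        refine integral_congr_ae ?_
        filter_upwards [coeFn_pullback hp f] with z hz
        rw [hz, RCLike.star_def, Complex.mul_conj, Complex.normSq_eq_norm_sq, NNReal.smul_def,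
          Complex.real_smul, mul_comm]
        simp [d]

theorem continuous_mulRep_pullback [SigmaFinite μ] {p : Z → X}
    (hp : Measure.QuasiMeasurePreserving p ν μ) :
    Continuous[inferInstance, ultraweak (Lp ℂ 2 ν)] ((mulRep ν).comp (pullback hp)) := by
  refine continuous_ultraweak_of_vector _ fun ξ η => ?_
  have h := fun ζ => continuous_inner_mulRep_pullback_self hp ζ
  have hpol : (fun f : LInf μ => ⟪ξ, (mulRep ν).comp (pullback hp) f η⟫_ℂ) = fun f =>
      (⟪ξ + η, mulRep ν (pullback hp f) (ξ + η)⟫_ℂ - ⟪ξ - η, mulRep ν (pullback hp f) (ξ - η)⟫_ℂ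
        - Complex.I * ⟪ξ + Complex.I • η, mulRep ν (pullback hp f) (ξ + Complex.I • η)⟫_ℂ
        + Complex.I * ⟪ξ - Complex.I • η, mulRep ν (pullback hp f) (ξ - Complex.I • η)⟫_ℂ) / 4 := by
    funext f
    change ⟪ξ, mulRep ν (pullback hp f) η⟫_ℂ = _
    simp only [map_add, map_sub, map_smul, inner_add_left, inner_add_right, inner_sub_left,
      inner_sub_right, inner_smul_left, inner_smul_right, Complex.conj_I]
    ring_nf
    simp only [Complex.I_sq]
    ring
  rw [hpol]
  exact ((((h _).sub (h _)).sub ((h _).const_mul _)).add ((h _).const_mul _)).div_const _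

/-- If `p` maps a piece of `ν` to `μ`, then every functional in `L¹(μ)` is a vector functional of
the multiplication representation through `p`. -/
theorem exists_inner_mulRep_pullback_eq_pairing {p : Z → X}
    (hp : Measure.QuasiMeasurePreserving p ν μ) {E : Set Z} (hE : MeasurableSet E)
    (hpE : MeasurePreserving p (ν.restrict E) μ) (h : Lp ℂ 1 μ) :
    ∃ ξ η : Lp ℂ 2 ν, ∀ f, ⟪ξ, mulRep ν (pullback hp f) η⟫_ℂ = pairing h f := by
  have hm : Measurable h := (Lp.stronglyMeasurable h).measurable
  have hpm := hp.measurable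
  have hint : Integrable (E.indicator fun z => ‖h (p z)‖) ν := by
    rw [integrable_indicator_iff hE]
    exact ((hpE.integrable_comp hm.norm.aestronglyMeasurable).2 (L1.integrable_coeFn h).norm :)
  -- On `E`, split `h ∘ p` as `b · conj a` with `|a|² = |b|² = |h ∘ p|`. Zeros of `h ∘ p` are
  -- harmless, as `0 / 0 = 0`. Cutting to `E`, where `p` preserves measure, makes both factors
  -- square integrable.
  let a : Z → ℂ := E.indicator fun z => (Real.sqrt ‖h (p z)‖ : ℝ)
  let b : Z → ℂ := E.indicator fun z => h (p z) / (Real.sqrt ‖h (p z)‖ : ℝ)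
  have ham : Measurable a := Measurable.indicator (by fun_prop) hE
  have hbm : Measurable b := Measurable.indicator (by fun_prop) hE
  have ha : MemLp a 2 ν := by
    rw [memLp_two_iff_integrable_sq_norm ham.aestronglyMeasurable]
    convert hint using 1
    funext z
    by_cases hz : z ∈ E <;> simp [a, hz, Real.sq_sqrt]
  have hb : MemLp b 2 ν := by
    rw [memLp_two_iff_integrable_sq_norm hbm.aestronglyMeasurable]
    convert hint using 1
    funext z
    by_cases hz : z ∈ E
    · simp only [b, Set.indicator_of_mem hz, norm_div, Complex.norm_real, div_pow,
        Real.norm_of_nonneg (Real.sqrt_nonneg _), Real.sq_sqrt (norm_nonneg _)]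
      by_cases h0 : ‖h (p z)‖ = 0
      · simp [h0]
      · field_simp
    · simp [b, hz]
  have hab : ∀ z, b z * star (a z) = E.indicator (fun z => h (p z)) z := by
    intro z
    by_cases hz : z ∈ E
    · simp only [a, b, Set.indicator_of_mem hz, RCLike.star_def, Complex.conj_ofReal]
      by_cases h0 : h (p z) = 0
      · simp [h0]
      · refine div_mul_cancel₀ _ ?_
        simpa using Real.sqrt_ne_zero'.2 (norm_pos_iff.2 h0)
    · simp [a, b, hz]
  refine ⟨ha.toLp a, hb.toLp b, fun f => ?_⟩
  have hf : Measurable f := (Lp.stronglyMeasurable (toLp f)).measurable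
  calc ⟪ha.toLp a, mulRep ν (pullback hp f) (hb.toLp b)⟫_ℂ
      = ∫ z, E.indicator (fun z => f (p z) * h (p z)) z ∂ν := by
        rw [inner_mulRep]
        refine integral_congr_ae ?_
        filter_upwards [coeFn_pullback hp f, ha.coeFn_toLp, hb.coeFn_toLp] with z h1 h2 h3
        rw [h1, h2, h3, hab]
        by_cases hz : z ∈ E <;> simp [hz]
    _ = ∫ z in E, f (p z) * h (p z) ∂ν := integral_indicator hE
    _ = pairing h f := by
        have key : ∀ φ : X → ℂ, Measurable φ → ∫ z in E, φ (p z) ∂ν = ∫ x, φ x ∂μ := by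
          intro φ hφ
          rw [← hpE.map_eq, integral_map hpm.aemeasurable hφ.aestronglyMeasurable]
        exact key _ (hf.mul hm)

/-- Normality gives one comparison of topologies. For the other, each functional defining `σ(L^∞,
L¹)` is a vector functional of the representation, hence weak* continuous on the image. -/
theorem isEmbedding_mulRep_pullback [SigmaFinite μ] [SigmaFinite ν] {p : Z → X}
    (hp : Measure.QuasiMeasurePreserving p ν μ) {E : Set Z} (hE : MeasurableSet E)
    (hpE : MeasurePreserving p (ν.restrict E) μ) :
    @Topology.IsEmbedding _ _ _ (ultraweak (Lp ℂ 2 ν)) ((mulRep ν).comp (pullback hp)) := by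
  refine @Topology.IsEmbedding.mk _ _ _ (ultraweak _) _
    (@Topology.IsInducing.mk _ _ _ (ultraweak _) _ (le_antisymm ?_ (le_iInf fun h => ?_))) ?_
  · exact continuous_iff_le_induced.1 (continuous_mulRep_pullback hp)
  · obtain ⟨ξ, η, hξη⟩ := exists_inner_mulRep_pullback_eq_pairing hp hE hpE h
    have hc := continuous_iff_le_induced.1 (continuous_inner_ultraweak ξ η)
    have := induced_mono (g := (mulRep ν).comp (pullback hp)) hc
    rw [induced_compose] at this
    refine this.trans_eq ?_
    congr 1
    exact funext hξη
  · rw [StarAlgHom.coe_comp]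
    refine mulRep_injective.comp ((injective_iff_map_eq_zero _).2 fun f hf => ext ?_)
    have h0 : ∀ᵐ z ∂ν, f (p z) = 0 := by
      filter_upwards [coeFn_pullback hp f, coeFn_zero (μ := ν)] with z h1 h2
      rw [← h1, hf, h2]
    have hf' : Measurable f := (Lp.stronglyMeasurable (toLp f)).measurable
    have key : ∀ φ : X → ℂ, Measurable φ → (∀ᵐ z ∂ν, φ (p z) = 0) → ∀ᵐ x ∂μ, φ x = 0 := by
      intro φ hφ h
      have hs : MeasurableSet {x | φ x = 0} := hφ (measurableSet_singleton 0)
      rw [← hpE.map_eq, ae_map_iff hp.measurable.aemeasurable hs]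
      exact ae_restrict_of_ae h
    filter_upwards [key f hf' h0, coeFn_zero (μ := μ)] with x h2 h3
    rw [h2, h3]

/-- The star homomorphism `f ⊗ g ↦ (f ∘ p) (g ∘ q)`. -/
noncomputable def pairPullback {p : Z → X} {q : Z → Y} (hp : Measure.QuasiMeasurePreserving p ν μ)
    (hq : Measure.QuasiMeasurePreserving q ν μ') : (LInf μ ⊗[ℂ] LInf μ') →⋆ₐ[ℂ] LInf ν :=
  { Algebra.TensorProduct.productMap (pullback hp : LInf μ →ₐ[ℂ] LInf ν)
      (pullback hq : LInf μ' →ₐ[ℂ] LInf ν) with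
    map_star' := fun t => by
      change Algebra.TensorProduct.productMap (pullback hp : LInf μ →ₐ[ℂ] LInf ν)
        (pullback hq : LInf μ' →ₐ[ℂ] LInf ν) (star t) = star (Algebra.TensorProduct.productMap
          (pullback hp : LInf μ →ₐ[ℂ] LInf ν) (pullback hq : LInf μ' →ₐ[ℂ] LInf ν) t)
      induction t using TensorProduct.induction_on with
      | zero => rw [star_zero, map_zero, star_zero]
      | tmul f g =>
        rw [TensorProduct.star_tmul, Algebra.TensorProduct.productMap_apply_tmul,
          Algebra.TensorProduct.productMap_apply_tmul, star_mul']
        change pullback hp (star f) * pullback hq (star g) =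
          star (pullback hp f) * star (pullback hq g)
        rw [map_star, map_star]
      | add s t hs ht => rw [star_add, map_add, map_add, star_add, hs, ht] }

theorem pairPullback_tmul {p : Z → X} {q : Z → Y} (hp : Measure.QuasiMeasurePreserving p ν μ)
    (hq : Measure.QuasiMeasurePreserving q ν μ') (f : LInf μ) (g : LInf μ') :
    pairPullback hp hq (f ⊗ₜ[ℂ] g) = pullback hp f * pullback hq g :=
  Algebra.TensorProduct.productMap_apply_tmul _ _ _ _

theorem coeFn_pairPullback_tmul {p : Z → X} {q : Z → Y}
    (hp : Measure.QuasiMeasurePreserving p ν μ) (hq : Measure.QuasiMeasurePreserving q ν μ')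
    (f : LInf μ) (g : LInf μ') :
    ⇑(pairPullback hp hq (f ⊗ₜ[ℂ] g)) =ᵐ[ν] fun z => f (p z) * g (q z) := by
  rw [pairPullback_tmul]
  filter_upwards [coeFn_mul (pullback hp f) (pullback hq g), coeFn_pullback hp f,
    coeFn_pullback hq g] with z h1 h2 h3
  rw [h1, h2, h3]

/-- The representation of `L^∞(μ) ⊙ L^∞(μ')` on `L²(ν)` in which `f ⊗ g` acts as multiplication by
`(f ∘ p) (g ∘ q)`. -/
noncomputable def pairRep {p : Z → X} {q : Z → Y} (hp : Measure.QuasiMeasurePreserving p ν μ)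
    (hq : Measure.QuasiMeasurePreserving q ν μ') :
    (LInf μ ⊗[ℂ] LInf μ') →⋆ₐ[ℂ] (Lp ℂ 2 ν →L[ℂ] Lp ℂ 2 ν) :=
  (mulRep ν).comp (pairPullback hp hq)

theorem coeFn_pairRep_tmul {p : Z → X} {q : Z → Y}
    (hp : Measure.QuasiMeasurePreserving p ν μ) (hq : Measure.QuasiMeasurePreserving q ν μ')
    (f : LInf μ) (g : LInf μ') (ξ : Lp ℂ 2 ν) :
    ⇑(pairRep hp hq (f ⊗ₜ[ℂ] g) ξ) =ᵐ[ν] fun z => f (p z) * g (q z) * ξ z := by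
  filter_upwards [coeFn_mulRep (pairPullback hp hq (f ⊗ₜ[ℂ] g)) ξ,
    coeFn_pairPullback_tmul hp hq f g] with z h1 h2
  rw [← h2]
  exact h1

theorem restrictLeft_pairRep {p : Z → X} {q : Z → Y}
    (hp : Measure.QuasiMeasurePreserving p ν μ) (hq : Measure.QuasiMeasurePreserving q ν μ') :
    (pairRep hp hq).restrictLeft = (mulRep ν).comp (pullback hp) := by
  ext1 f
  change mulRep ν (pairPullback hp hq (f ⊗ₜ[ℂ] 1)) = mulRep ν (pullback hp f)
  rw [pairPullback_tmul, map_one, mul_one]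

theorem restrictRight_pairRep {p : Z → X} {q : Z → Y}
    (hp : Measure.QuasiMeasurePreserving p ν μ) (hq : Measure.QuasiMeasurePreserving q ν μ') :
    (pairRep hp hq).restrictRight = (mulRep ν).comp (pullback hq) := by
  ext1 g
  change mulRep ν (pairPullback hp hq (1 ⊗ₜ[ℂ] g)) = mulRep ν (pullback hq g)
  rw [pairPullback_tmul, map_one, one_mul]

/-- Write `t = ∑ cᵢ ⊗ bᵢ` with `bᵢ` from a basis of the right factor. By Fubini, for almost every
`x` the combination `∑ cᵢ(x) bᵢ` vanishes in `L^∞(μ')`, so independence gives `cᵢ(x) = 0`. -/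
theorem pairPullback_prod_injective [SFinite μ] [SFinite μ'] :
    Function.Injective (pairPullback (Measure.quasiMeasurePreserving_fst (μ := μ) (ν := μ'))
      (Measure.quasiMeasurePreserving_snd (μ := μ) (ν := μ'))) := by
  rw [injective_iff_map_eq_zero]
  intro t ht
  let b := Module.Basis.ofVectorSpace ℂ (LInf μ')
  obtain ⟨c, rfl⟩ := TensorProduct.eq_repr_basis_right b t
  have hsum : ∀ᵐ z ∂μ.prod μ', ∑ i ∈ c.support, c i z.1 * b i z.2 = 0 := by
    rw [Finsupp.sum, map_sum] at ht
    have h1 := coeFn_finset_sum c.support fun i =>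
      pairPullback (Measure.quasiMeasurePreserving_fst (μ := μ) (ν := μ'))
        (Measure.quasiMeasurePreserving_snd (μ := μ) (ν := μ')) (c i ⊗ₜ[ℂ] b i)
    rw [ht] at h1
    have h2 : ∀ᵐ z ∂μ.prod μ', ∀ i ∈ c.support,
        pairPullback (Measure.quasiMeasurePreserving_fst (μ := μ) (ν := μ'))
          (Measure.quasiMeasurePreserving_snd (μ := μ) (ν := μ')) (c i ⊗ₜ[ℂ] b i) z =
          c i z.1 * b i z.2 :=
      (Finset.eventually_all _).2 fun i _ => coeFn_pairPullback_tmul _ _ _ _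
    filter_upwards [h1, h2, coeFn_zero (μ := μ.prod μ')] with z h1 h2 h3
    rw [← Finset.sum_congr rfl h2, ← h1, h3]
  have hc : ∀ i ∈ c.support, c i = 0 := by
    have h1 : ∀ᵐ x ∂μ, ∀ i ∈ c.support, c i x = 0 := by
      filter_upwards [Measure.ae_ae_of_ae_prod hsum] with x hx
      refine linearIndependent_iff'.1 b.linearIndependent c.support (fun i => c i x) (ext ?_)
      have h2 : ∀ᵐ y ∂μ', ∀ i ∈ c.support, (c i x • b i : LInf μ') y = c i x * b i y :=
        (Finset.eventually_all _).2 fun i _ => coeFn_smul _ _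
      filter_upwards [hx, h2, coeFn_finset_sum c.support fun i => c i x • b i,
        coeFn_zero (μ := μ')] with y h3 h4 h5 h6
      rw [h5, h6, Finset.sum_congr rfl h4, h3]
    intro i hi
    refine ext ?_
    filter_upwards [h1, coeFn_zero (μ := μ)] with x h2 h3
    rw [h2 i hi, h3]
  exact Finset.sum_eq_zero fun i hi => by
    simp only [hc i hi, TensorProduct.zero_tmul]

/-- The spatial weak* tensor product of two `L^∞` algebras. -/
theorem isWeakStarTensor_pairRep_prod [SigmaFinite μ] [SigmaFinite μ'] {E : Set X} {F : Set Y}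
    (hE : MeasurableSet E) (hμE : μ E = 1) (hF : MeasurableSet F) (hμF : μ' F = 1) :
    IsWeakStarTensor (pairRep (Measure.quasiMeasurePreserving_fst (μ := μ) (ν := μ'))
      (Measure.quasiMeasurePreserving_snd (μ := μ) (ν := μ'))) where
  injective := mulRep_injective.comp pairPullback_prod_injective
  left := by
    -- Over a strip `X × F` with `μ'(F) = 1` the first projection preserves measure.
    have hprob : IsProbabilityMeasure (μ'.restrict F) := ⟨by simpa using hμF⟩
    have h : MeasurePreserving Prod.fst ((μ.prod μ').restrict (Set.univ ×ˢ F)) μ := by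
      rw [← Measure.prod_restrict, Measure.restrict_univ]
      exact measurePreserving_fst
    have := isEmbedding_mulRep_pullback Measure.quasiMeasurePreserving_fst
      (MeasurableSet.univ.prod hF) h
    rwa [← restrictLeft_pairRep _ (Measure.quasiMeasurePreserving_snd (μ := μ) (ν := μ'))] at this
  right := by
    have hprob : IsProbabilityMeasure (μ.restrict E) := ⟨by simpa using hμE⟩
    have h : MeasurePreserving Prod.snd ((μ.prod μ').restrict (E ×ˢ Set.univ)) μ' := by
      rw [← Measure.prod_restrict, Measure.restrict_univ]
      exact measurePreserving_snd
    have := isEmbedding_mulRep_pullback Measure.quasiMeasurePreserving_snd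
      (hE.prod MeasurableSet.univ) h
    rwa [← restrictRight_pairRep (Measure.quasiMeasurePreserving_fst (μ := μ) (ν := μ'))] at this

end LInf

/-! ### Normal states on a maximal weak* tensor product -/

section NormalFunctionals

variable {H : Type*} [NormedAddCommGroup H] [InnerProductSpace ℂ H] [CompleteSpace H]
  {K : Type*} [NormedAddCommGroup K] [InnerProductSpace ℂ K] [CompleteSpace K]

/-- Normal functionals are thereby norm continuous, so they belong to the dual in which the predual
sits. -/
theorem continuous_norm_ultraweak :
    Continuous[inferInstance, ultraweak H] (fun T : H →L[ℂ] H => T) := by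
  refine continuous_ultraweak_rng fun ξ η => ?_
  let L : (H →L[ℂ] H) →ₗ[ℂ] ℂ :=
    { toFun := fun T => ∑' n, ⟪ξ n, T (η n)⟫_ℂ
      map_add' := fun S T => by
        simp only [add_apply, inner_add_right]
        exact (summable_ultraweak ξ η S).tsum_add (summable_ultraweak ξ η T)
      map_smul' := fun c T => by
        simp only [smul_apply, inner_smul_right, tsum_mul_left]
        rfl }
  refine (L.mkContinuous (∑' n, ‖ξ n‖ * ‖η n‖) fun T => ?_).continuous
  rw [← tsum_mul_right]
  have hs := (summable_norm_mul_norm ξ η).mul_right ‖T‖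
  refine tsum_of_norm_bounded hs.hasSum fun n => (norm_inner_le_norm _ _).trans ?_
  rw [mul_assoc, mul_comm ‖η n‖]
  exact mul_le_mul_of_nonneg_left (T.le_opNorm _) (norm_nonneg _)

/-- The vector functional `T ↦ ⟪ξ, π(T) ξ⟫` of a normal representation. -/
noncomputable def vectorFunctional {S : StarSubalgebra ℂ (H →L[ℂ] H)} (π : S →⋆ₐ[ℂ] (K →L[ℂ] K))
    (hπ : IsNormalRep π) (ξ : K) : S.predual :=
  have hc : Continuous[S.ultraweak, inferInstance] fun T : S => ⟪ξ, π T ξ⟫_ℂ :=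
    @Continuous.comp _ _ _ S.ultraweak (ultraweak K) _ _ _ (continuous_inner_ultraweak ξ ξ) hπ
  ⟨{ toFun := fun T => ⟪ξ, π T ξ⟫_ℂ
     map_add' := fun S T => by rw [map_add, add_apply, inner_add_right]
     map_smul' := fun c T => by rw [map_smul, smul_apply, inner_smul_right]; rfl
     cont := by
      have hid : Continuous[inferInstance, S.ultraweak] (fun T : S => T) :=
        continuous_induced_rng.2 (@Continuous.comp _ _ _ _ _ (ultraweak H) Subtype.val
          (fun T => T) continuous_norm_ultraweak continuous_subtype_val)
      exact @Continuous.comp _ _ _ _ S.ultraweak _ _ _ hc hid }, hc⟩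

theorem vectorFunctional_apply {S : StarSubalgebra ℂ (H →L[ℂ] H)} (π : S →⋆ₐ[ℂ] (K →L[ℂ] K))
    (hπ : IsNormalRep π) (ξ : K) (T : S) :
    (vectorFunctional π hπ ξ : StrongDual ℂ S) T = ⟪ξ, π T ξ⟫_ℂ := rfl

theorem not_separableSpace_of_one_le_norm_sub {E ι : Type*} [SeminormedAddCommGroup E]
    [Uncountable ι] (φ : ι → E) (h : ∀ i j, i ≠ j → 1 ≤ ‖φ i - φ j‖) :
    ¬ TopologicalSpace.SeparableSpace E := by
  intro _
  have hd : (Set.univ : Set ι).PairwiseDisjoint fun i => Metric.ball (φ i) (1 / 2) := by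
    intro i _ j _ hij
    refine Metric.ball_disjoint_ball ?_
    rw [dist_eq_norm]
    norm_num
    exact h i j hij
  exact Set.not_countable_univ
    (hd.countable_of_isOpen (fun i _ => Metric.isOpen_ball)
      fun i _ => Metric.nonempty_ball.2 (by norm_num))

end NormalFunctionals

section Maximal

variable {X Y Z : Type} [MeasurableSpace X] [MeasurableSpace Y] [MeasurableSpace Z]
  {μ : Measure X} {μ' : Measure Y} [SigmaFinite μ] [SigmaFinite μ']

/-- A maximal weak* tensor product maps to the von Neumann algebra generated by any normal
multiplication representation, provided that one of them is a weak* tensor product. -/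
theorem IsMaximalWeakStarTensor.exists_hom_pairRep {H : Type*} [NormedAddCommGroup H]
    [InnerProductSpace ℂ H] [CompleteSpace H] {α : (LInf μ ⊗[ℂ] LInf μ') →⋆ₐ[ℂ] (H →L[ℂ] H)}
    (hα : IsMaximalWeakStarTensor.{0, 0, _, 0} α) {ι : Type} {ν : ι → Measure Z}
    {p : Z → X} {q : Z → Y} (hp : ∀ i, Measure.QuasiMeasurePreserving p (ν i) μ)
    (hq : ∀ i, Measure.QuasiMeasurePreserving q (ν i) μ') (i₀ : ι)
    (h₀ : IsWeakStarTensor (LInf.pairRep (hp i₀) (hq i₀))) (i : ι) :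
    ∃ Φ : weakStarTensor α →⋆ₐ[ℂ] weakStarTensor (LInf.pairRep (hp i) (hq i)),
      IsNormalHom Φ ∧
        ∀ t, Φ (toWeakStarTensor α t) = toWeakStarTensor (LInf.pairRep (hp i) (hq i)) t := by
  -- A single `β i` may fail to be injective, so maximality is applied to the sum containing `i₀`
  -- and followed by the coordinate map.
  let β := fun i => LInf.pairRep (hp i) (hq i)
  have hβ : IsWeakStarTensor (tensorDirectSum β) := by
    refine isWeakStarTensor_tensorDirectSum β (fun i => ?_) (fun i => ?_) i₀ h₀
    · simp only [β, LInf.restrictLeft_pairRep]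
      exact LInf.continuous_mulRep_pullback (hp i)
    · simp only [β, LInf.restrictRight_pairRep]
      exact LInf.continuous_mulRep_pullback (hq i)
  obtain ⟨Φ, hΦ, hΦ'⟩ := hα.exists_extension _ _ hβ
  obtain ⟨Ψ, hΨ, hΨ'⟩ := exists_coordinate_hom β i
  refine ⟨Ψ.comp Φ, ?_, fun t => ?_⟩
  · exact @Continuous.comp _ _ _ (weakStarTensor α).ultraweak
      (weakStarTensor (tensorDirectSum β)).ultraweak (weakStarTensor (β i)).ultraweak _ _ hΨ hΦ
  · rw [StarAlgHom.comp_apply, hΦ', hΨ']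

end Maximal

/-! ### The measures `μ_x` -/

section LineMeasure

theorem measurePreserving_fst_lineMeasure (x : ℝ) :
    MeasurePreserving Prod.fst (lineMeasure x) volume := by
  refine ⟨measurable_fst, ?_⟩
  rw [lineMeasure, Measure.map_map measurable_fst (by fun_prop)]
  exact Measure.map_id

theorem measurePreserving_snd_lineMeasure (x : ℝ) :
    MeasurePreserving Prod.snd (lineMeasure x) volume := by
  refine ⟨measurable_snd, ?_⟩
  rw [lineMeasure, Measure.map_map measurable_snd (by fun_prop)]
  exact map_add_left_eq_self volume x

/-- The representation of `L^∞(ℝ) ⊙ L^∞(ℝ)` on `L²(μ_x)`. -/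
noncomputable def lineRep (x : ℝ) :
    (LInf (volume : Measure ℝ) ⊗[ℂ] LInf (volume : Measure ℝ)) →⋆ₐ[ℂ]
      (Lp ℂ 2 (lineMeasure x) →L[ℂ] Lp ℂ 2 (lineMeasure x)) :=
  LInf.pairRep (measurePreserving_fst_lineMeasure x).quasiMeasurePreserving
    (measurePreserving_snd_lineMeasure x).quasiMeasurePreserving

theorem coeFn_lineRep_tmul (x : ℝ) (f g : LInf (volume : Measure ℝ))
    (ξ : Lp ℂ 2 (lineMeasure x)) :
    (lineRep x (f ⊗ₜ[ℂ] g) ξ : ℝ × ℝ → ℂ) =ᵐ[lineMeasure x] fun p => f p.1 * g p.2 * ξ p :=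
  LInf.coeFn_pairRep_tmul _ _ f g ξ

theorem inner_lineRep_lineVector (x : ℝ) (f g : LInf (volume : Measure ℝ)) :
    ⟪lineVector x, lineRep x (f ⊗ₜ[ℂ] g) (lineVector x)⟫_ℂ =
      ∫ y in Set.Icc (0 : ℝ) 1, f y * g (x + y) := by
  have hf : Measurable f := (Lp.stronglyMeasurable (LInf.toLp f)).measurable
  have hg : Measurable g := (Lp.stronglyMeasurable (LInf.toLp g)).measurable
  have hB := measurableSet_lineBox x
  rw [L2.inner_def]
  calc ∫ p, ⟪lineVector x p, lineRep x (f ⊗ₜ[ℂ] g) (lineVector x) p⟫_ℂ ∂lineMeasure x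
      = ∫ p, (Set.Icc (0 : ℝ) 1 ×ˢ Set.Icc x (1 + x)).indicator
          (fun p : ℝ × ℝ => f p.1 * g p.2) p ∂lineMeasure x := by
        refine integral_congr_ae ?_
        have hv : ⇑(lineVector x) =ᵐ[lineMeasure x] _ :=
          indicatorConstLp_coeFn (hs := hB) (hμs := lineMeasure_lineBox_ne_top x)
        filter_upwards [coeFn_lineRep_tmul x f g (lineVector x), hv] with p h1 h2
        rw [h1, h2]
        by_cases hp : p ∈ Set.Icc (0 : ℝ) 1 ×ˢ Set.Icc x (1 + x)
        · simp only [Set.indicator_of_mem hp]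
          simp
        · simp only [Set.indicator_of_notMem hp]
          simp
    _ = ∫ y, (Set.Icc (0 : ℝ) 1 ×ˢ Set.Icc x (1 + x)).indicator
          (fun p : ℝ × ℝ => f p.1 * g p.2) (y, x + y) := by
        rw [lineMeasure, integral_map (by fun_prop)]
        exact (Measurable.indicator (by fun_prop) hB).aestronglyMeasurable
    _ = ∫ y, (Set.Icc (0 : ℝ) 1).indicator (fun y => f y * g (x + y)) y := by
        refine integral_congr_ae (.of_forall fun y => ?_)
        by_cases hy : y ∈ Set.Icc (0 : ℝ) 1
        · have hy' : (y, x + y) ∈ Set.Icc (0 : ℝ) 1 ×ˢ Set.Icc x (1 + x) :=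
            ⟨hy, by constructor <;> simp only <;> linarith [hy.1, hy.2]⟩
          simp only [Set.indicator_of_mem hy, Set.indicator_of_mem hy']
        · have hy' : (y, x + y) ∉ Set.Icc (0 : ℝ) 1 ×ˢ Set.Icc x (1 + x) := fun h => hy h.1
          simp only [Set.indicator_of_notMem hy, Set.indicator_of_notMem hy']
    _ = ∫ y in Set.Icc (0 : ℝ) 1, f y * g (x + y) := integral_indicator measurableSet_Icc

end LineMeasure

/-! ### Separating projections -/

section Projections

namespace LInf

variable {X : Type*} [MeasurableSpace X] {μ : Measure X}

/-- The class of a characteristic function. -/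
noncomputable def char (μ : Measure X) (s : Set X) (hs : MeasurableSet s) : LInf μ :=
  mk (s.indicator fun _ => (1 : ℂ)) ((memLp_top_const (1 : ℂ)).indicator hs)

theorem coeFn_char (s : Set X) (hs : MeasurableSet s) :
    ⇑(char μ s hs) =ᵐ[μ] s.indicator fun _ => (1 : ℂ) := coeFn_mk _ _

theorem star_char (s : Set X) (hs : MeasurableSet s) : star (char μ s hs) = char μ s hs := by
  refine ext ?_
  filter_upwards [coeFn_star (char μ s hs), coeFn_char (μ := μ) s hs] with x h1 h2
  rw [h1, h2]
  by_cases hx : x ∈ s <;> simp [hx]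

theorem char_mul_self (s : Set X) (hs : MeasurableSet s) :
    char μ s hs * char μ s hs = char μ s hs := by
  refine ext ?_
  filter_upwards [coeFn_mul (char μ s hs) (char μ s hs), coeFn_char (μ := μ) s hs] with x h1 h2
  rw [h1, h2]
  by_cases hx : x ∈ s <;> simp [hx]

theorem char_mul_of_disjoint {s t : Set X} (hs : MeasurableSet s) (ht : MeasurableSet t)
    (hst : Disjoint s t) : char μ s hs * char μ t ht = 0 := by
  refine ext ?_
  filter_upwards [coeFn_mul (char μ s hs) (char μ t ht), coeFn_char (μ := μ) s hs,
    coeFn_char (μ := μ) t ht, coeFn_zero (μ := μ)] with x h1 h2 h3 h4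
  rw [h1, h2, h3, h4]
  by_cases hx : x ∈ s
  · simp [Set.disjoint_left.1 hst hx]
  · simp [hx]

end LInf

/-- The projection `∑ₖ χ(Iₖ) ⊗ χ(x + Iₖ)` for the partition of `[0, 1)` into `n` intervals. -/
noncomputable def diagProj (x : ℝ) (n : ℕ) :
    LInf (volume : Measure ℝ) ⊗[ℂ] LInf (volume : Measure ℝ) :=
  ∑ k ∈ Finset.range n,
    LInf.char volume (Set.Ico (k / n : ℝ) ((k + 1) / n)) measurableSet_Ico ⊗ₜ[ℂ]
      LInf.char volume (Set.Ico (x + k / n) (x + (k + 1) / n)) measurableSet_Ico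

theorem disjoint_Ico_div {n : ℕ} (hn : 0 < n) {k l : ℕ} (hkl : k ≠ l) :
    Disjoint (Set.Ico (k / n : ℝ) ((k + 1) / n)) (Set.Ico (l / n : ℝ) ((l + 1) / n)) := by
  have hn' : (0 : ℝ) < n := Nat.cast_pos.2 hn
  rw [Set.disjoint_left]
  rintro y ⟨h1, h2⟩ ⟨h3, h4⟩
  rw [div_le_iff₀ hn'] at h1 h3
  rw [lt_div_iff₀ hn'] at h2 h4
  have h5 : (k : ℝ) < l + 1 := by linarith
  have h6 : (l : ℝ) < k + 1 := by linarith
  norm_cast at h5 h6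
  omega

/-- Cross terms vanish because the left legs have disjoint supports. As a projection of the
algebraic tensor product, it has norm at most `1` in every star representation. -/
theorem isStarProjection_diagProj (x : ℝ) {n : ℕ} (hn : 0 < n) :
    IsStarProjection (diagProj x n) := by
  constructor
  · rw [IsIdempotentElem, diagProj, Finset.sum_mul_sum]
    refine Finset.sum_congr rfl fun k hk => ?_
    rw [Finset.sum_eq_single_of_mem k hk, Algebra.TensorProduct.tmul_mul_tmul,
      LInf.char_mul_self, LInf.char_mul_self]
    intro l _ hl
    rw [Algebra.TensorProduct.tmul_mul_tmul,
      LInf.char_mul_of_disjoint _ _ (disjoint_Ico_div hn hl.symm), TensorProduct.zero_tmul]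
  · rw [IsSelfAdjoint, diagProj, star_sum]
    refine Finset.sum_congr rfl fun k _ => ?_
    rw [TensorProduct.star_tmul, LInf.star_char, LInf.star_char]

theorem norm_map_diagProj_le {H : Type*} [NormedAddCommGroup H] [InnerProductSpace ℂ H]
    [CompleteSpace H] (α : (LInf (volume : Measure ℝ) ⊗[ℂ] LInf (volume : Measure ℝ)) →⋆ₐ[ℂ]
      (H →L[ℂ] H)) (x : ℝ) {n : ℕ} (hn : 0 < n) : ‖α (diagProj x n)‖ ≤ 1 :=
  IsStarProjection.norm_le _ ((isStarProjection_diagProj x hn).map α)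

theorem setIntegral_char_mul_char (x : ℝ) {I J : Set ℝ} (hI : MeasurableSet I)
    (hJ : MeasurableSet J) :
    ∫ y in Set.Icc (0 : ℝ) 1, LInf.char volume I hI y * LInf.char volume J hJ (x + y) =
      (volume.real (Set.Icc (0 : ℝ) 1 ∩ (I ∩ (x + ·) ⁻¹' J)) : ℂ) := by
  have hm : MeasurableSet (I ∩ (x + ·) ⁻¹' J) := hI.inter (hJ.preimage (by fun_prop))
  have hq : Measure.QuasiMeasurePreserving (x + ·) (volume : Measure ℝ) volume :=
    (measurePreserving_add_left volume x).quasiMeasurePreserving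
  calc _ = ∫ y in Set.Icc (0 : ℝ) 1, (I ∩ (x + ·) ⁻¹' J).indicator (fun _ => (1 : ℂ)) y := by
        refine integral_congr_ae (ae_restrict_of_ae ?_)
        filter_upwards [LInf.coeFn_char I hI, hq.ae (LInf.coeFn_char J hJ)] with y h1 h2
        rw [h1, h2]
        by_cases hy : y ∈ I <;> by_cases hy' : x + y ∈ J <;> simp [hy, hy']
    _ = _ := by
        rw [integral_indicator_const _ hm, measureReal_restrict_apply hm, Set.inter_comm]
        simp

theorem inner_lineRep_diagProj (x z : ℝ) (n : ℕ) :
    ⟪lineVector z, lineRep z (diagProj x n) (lineVector z)⟫_ℂ =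
      ∑ k ∈ Finset.range n, (volume.real (Set.Icc (0 : ℝ) 1 ∩ (Set.Ico (k / n : ℝ) ((k + 1) / n) ∩
        (z + ·) ⁻¹' Set.Ico (x + k / n) (x + (k + 1) / n))) : ℂ) := by
  rw [diagProj, map_sum, sum_apply, inner_sum]
  refine Finset.sum_congr rfl fun k _ => ?_
  rw [inner_lineRep_lineVector, setIntegral_char_mul_char]

theorem inner_lineRep_diagProj_self (x : ℝ) {n : ℕ} (hn : 0 < n) :
    ⟪lineVector x, lineRep x (diagProj x n) (lineVector x)⟫_ℂ = 1 := by
  have hn' : (0 : ℝ) < n := Nat.cast_pos.2 hn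
  rw [inner_lineRep_diagProj]
  have h : ∀ k ∈ Finset.range n, ((volume.real (Set.Icc (0 : ℝ) 1 ∩
      (Set.Ico (k / n : ℝ) ((k + 1) / n) ∩
        (x + ·) ⁻¹' Set.Ico (x + k / n) (x + (k + 1) / n))) : ℝ) : ℂ) = ((1 / n : ℝ) : ℂ) := by
    intro k hk
    have hk' : (k : ℝ) + 1 ≤ n := by exact_mod_cast Finset.mem_range.1 hk
    have hset : Set.Icc (0 : ℝ) 1 ∩ (Set.Ico (k / n : ℝ) ((k + 1) / n) ∩
        (x + ·) ⁻¹' Set.Ico (x + k / n) (x + (k + 1) / n)) =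
        Set.Ico (k / n : ℝ) ((k + 1) / n) := by
      ext y
      simp only [Set.mem_inter_iff, Set.mem_preimage, Set.mem_Ico, Set.mem_Icc,
        add_le_add_iff_left, add_lt_add_iff_left, and_self, and_iff_right_iff_imp]
      rintro ⟨h1, h2⟩
      exact ⟨le_trans (by positivity) h1, h2.le.trans ((div_le_one hn').2 hk')⟩
    -- For `z = x` the two interval conditions coincide, so each of the `n` boxes contributes `1 /
    -- n`.
    rw [hset, Real.volume_real_Ico_of_le (by gcongr; linarith)]
    congr 1
    ring
  rw [Finset.sum_congr rfl h, Finset.sum_const, Finset.card_range, nsmul_eq_mul,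
    ← Complex.ofReal_natCast, ← Complex.ofReal_mul, mul_one_div_cancel hn'.ne',
    Complex.ofReal_one]

theorem inner_lineRep_diagProj_of_le {x z : ℝ} {n : ℕ} (h : 1 / (n : ℝ) ≤ |x - z|) :
    ⟪lineVector z, lineRep z (diagProj x n) (lineVector z)⟫_ℂ = 0 := by
  rw [inner_lineRep_diagProj]
  refine Finset.sum_eq_zero fun k _ => ?_
  have hset : Set.Icc (0 : ℝ) 1 ∩ (Set.Ico (k / n : ℝ) ((k + 1) / n) ∩
      (z + ·) ⁻¹' Set.Ico (x + k / n) (x + (k + 1) / n)) = ∅ := by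
    refine Set.eq_empty_of_forall_notMem ?_
    rintro y ⟨-, ⟨h1, h2⟩, h3, h4⟩
    -- Both `y` and `y + z - x` lie in the same interval of length `1 / n`, so the shift is smaller
    -- than `1 / n`.
    rw [add_div] at h2 h4
    refine absurd h (not_le.2 (abs_lt.2 ⟨?_, ?_⟩)) <;> linarith
  rw [hset, measureReal_empty, Complex.ofReal_zero]

end Projections

/-- The planar measure followed by the measures `μ_x`. -/
noncomputable def planeOrLine : Option ℝ → Measure (ℝ × ℝ)
  | none => (volume : Measure ℝ).prod volume
  | some x => lineMeasure x

theorem quasiMeasurePreserving_fst_planeOrLine :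
    ∀ i, Measure.QuasiMeasurePreserving Prod.fst (planeOrLine i) volume
  | none => Measure.quasiMeasurePreserving_fst
  | some x => (measurePreserving_fst_lineMeasure x).quasiMeasurePreserving

theorem quasiMeasurePreserving_snd_planeOrLine :
    ∀ i, Measure.QuasiMeasurePreserving Prod.snd (planeOrLine i) volume
  | none => Measure.quasiMeasurePreserving_snd
  | some x => (measurePreserving_snd_lineMeasure x).quasiMeasurePreserving

theorem isWeakStarTensor_plane : IsWeakStarTensor
    (LInf.pairRep (Measure.quasiMeasurePreserving_fst (μ := (volume : Measure ℝ))
      (ν := (volume : Measure ℝ))) Measure.quasiMeasurePreserving_snd) :=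
  LInf.isWeakStarTensor_pairRep_prod (E := Set.Ico 0 1) (F := Set.Ico 0 1) measurableSet_Ico
    (by simp) measurableSet_Ico (by simp)

/-- The index `none`, the plane, supplies the weak* tensor product that the line representation by
itself is not. -/
theorem IsMaximalWeakStarTensor.exists_hom_lineRep {H : Type*} [NormedAddCommGroup H]
    [InnerProductSpace ℂ H] [CompleteSpace H]
    {α : (LInf (volume : Measure ℝ) ⊗[ℂ] LInf (volume : Measure ℝ)) →⋆ₐ[ℂ] (H →L[ℂ] H)}
    (hα : IsMaximalWeakStarTensor.{0, 0, _, 0} α) (x : ℝ) :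
    ∃ π : weakStarTensor α →⋆ₐ[ℂ] (Lp ℂ 2 (lineMeasure x) →L[ℂ] Lp ℂ 2 (lineMeasure x)),
      IsNormalRep π ∧ ∀ t, π (toWeakStarTensor α t) = lineRep x t := by
  obtain ⟨Φ, hΦ, hΦ'⟩ : ∃ Φ : weakStarTensor α →⋆ₐ[ℂ] weakStarTensor (lineRep x),
      IsNormalHom Φ ∧ ∀ t, Φ (toWeakStarTensor α t) = toWeakStarTensor (lineRep x) t :=
    hα.exists_hom_pairRep quasiMeasurePreserving_fst_planeOrLine
      quasiMeasurePreserving_snd_planeOrLine none isWeakStarTensor_plane (some x)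
  refine ⟨(weakStarTensor (lineRep x)).subtype.comp Φ, ?_, fun t => ?_⟩
  · exact @Continuous.comp _ _ _ (weakStarTensor α).ultraweak
      (weakStarTensor (lineRep x)).ultraweak (ultraweak _) _ _ continuous_induced_dom hΦ
  · rw [StarAlgHom.comp_apply, hΦ']
    rfl

theorem mainTheorem7 :
    (∃ (H : Type 1) (_ : NormedAddCommGroup H) (_ : InnerProductSpace ℂ H) (_ : CompleteSpace H)
      (α : (LInf (volume : Measure ℝ) ⊗[ℂ] LInf (volume : Measure ℝ)) →⋆ₐ[ℂ] (H →L[ℂ] H)),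
      IsMaximalWeakStarTensor.{0, 0, 1, 0} α) ∧
    ∀ (H : Type*) [NormedAddCommGroup H] [InnerProductSpace ℂ H] [CompleteSpace H]
      (α : (LInf (volume : Measure ℝ) ⊗[ℂ] LInf (volume : Measure ℝ)) →⋆ₐ[ℂ] (H →L[ℂ] H)),
      IsMaximalWeakStarTensor.{0, 0, _, 0} α →
        ¬ TopologicalSpace.SeparableSpace (weakStarTensor α).predual ∧
        ∃ (π : ∀ x : ℝ, weakStarTensor α →⋆ₐ[ℂ]
              (Lp ℂ 2 (lineMeasure x) →L[ℂ] Lp ℂ 2 (lineMeasure x)))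
          (φ : ℝ → (weakStarTensor α).predual),
          (∀ x, IsNormalRep (π x)) ∧
          (∀ (x : ℝ) (f g : LInf (volume : Measure ℝ)) (ξ : Lp ℂ 2 (lineMeasure x)),
            (π x (toWeakStarTensor α (f ⊗ₜ[ℂ] g)) ξ : ℝ × ℝ → ℂ)
              =ᵐ[lineMeasure x] fun p => f p.1 * g p.2 * ξ p) ∧
          (∀ (x : ℝ) (T : weakStarTensor α),
            (φ x : StrongDual ℂ (weakStarTensor α)) T
              = ⟪lineVector x, π x T (lineVector x)⟫_ℂ) ∧
          (∀ (x : ℝ) (f g : LInf (volume : Measure ℝ)),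
            (φ x : StrongDual ℂ (weakStarTensor α)) (toWeakStarTensor α (f ⊗ₜ[ℂ] g))
              = ∫ y in Set.Icc (0 : ℝ) 1, f y * g (x + y)) ∧
          ∀ x y : ℝ, x ≠ y → 1 ≤ ‖φ x - φ y‖ := by
  refine ⟨⟨_, _, _, inferInstance, _,
    isMaximalWeakStarTensor_tensorDirectSum ⟨_, _, isWeakStarTensor_plane⟩⟩, ?_⟩
  intro H _ _ _ α hα
  choose π hπ hπα using hα.exists_hom_lineRep
  let φ : ℝ → (weakStarTensor α).predual := fun x =>
    vectorFunctional (π x) (hπ x) (lineVector x)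
  have hφ : ∀ x t, (φ x : StrongDual ℂ (weakStarTensor α)) (toWeakStarTensor α t) =
      ⟪lineVector x, lineRep x t (lineVector x)⟫_ℂ := fun x t => by
    rw [vectorFunctional_apply, hπα]
  have hsep : ∀ x y : ℝ, x ≠ y → 1 ≤ ‖φ x - φ y‖ := by
    intro x y hxy
    -- Here `1 / (n + 1) < |x - y|`, so with `n + 1` intervals the boxes along the line of `x` miss
    -- the line of `y`.
    obtain ⟨n, hn⟩ := exists_nat_one_div_lt (abs_pos.2 (sub_ne_zero.2 hxy))
    let T := toWeakStarTensor α (diagProj x (n + 1))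
    have hT : ‖T‖ ≤ 1 := norm_map_diagProj_le α x n.succ_pos
    have h1 : ((φ x - φ y : (weakStarTensor α).predual) : StrongDual ℂ (weakStarTensor α)) T =
        1 := by
      rw [Submodule.coe_sub, sub_apply, hφ, hφ, inner_lineRep_diagProj_self x n.succ_pos,
        inner_lineRep_diagProj_of_le (by exact_mod_cast hn.le), sub_zero]
    have h2 := ((φ x - φ y : (weakStarTensor α).predual) :
      StrongDual ℂ (weakStarTensor α)).le_opNorm T
    rw [h1, norm_one] at h2
    exact h2.trans (mul_le_of_le_one_right (norm_nonneg _) hT)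
  refine ⟨not_separableSpace_of_one_le_norm_sub φ hsep, π, φ, hπ, fun x f g ξ => ?_,
    fun x T => rfl, fun x f g => ?_, hsep⟩
  · rw [hπα]
    exact coeFn_lineRep_tmul x f g ξ
  · rw [hφ, inner_lineRep_lineVector]
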